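/- Let $N\ge 2$, $1<p<N$, and let $\Omega\subset\mathbb R^N$ be open and bounded. For Borel $B\subset\Omega$ let $\operatorname{cap}_p(B)=\inf\int_\Omega|\nabla w|^p$ over all $w\in W^{1,p}_0(\Omega)$ with $w\ge1$ a.e. in a neighbourhood of $B$; quasi continuity is meant with respect to $\operatorname{cap}_p$. Let $a:\Omega\times\mathbb R^N\to\mathbb R^N$ be a Carathéodory function for which there are $\alpha,\beta>0$ such that for a.e. $x\in\Omega$ and all $\xi\ne\xi'$ in $\mathbb R^N$ $$a(x,\xi)\cdot\xi\ge\alpha|\xi|^p,\qquad |a(x,\xi)|\le\beta|\xi|^{p-1},\qquad (a(x,\xi)-a(x,\xi'))\cdot(\xi-\xi')>0 .$$ Let $\mu$ be a nonnegative bounded Radon measure on $\Omega$, and let $\mu=\mu_d+\mu_c$ be its decomposition into nonnegative measures such that $\mu_d$ vanishes on Borel sets of zero $p$-capacity and $\mu_c$ is concentrated on a Borel set of zero $p$-capacity. Let $H:(0,\infty)\to(0,\infty)$ be continuous with finite limit $H(\infty)=\lim_{s\to\infty}H(s)$, and let $C,s_0>0$, $\gamma\ge0$ be such that $H(s)\le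 C s^{-\gamma}$ for $0<s<s_0$. Consider the problem $$-\operatorname{div}(a(x,\nabla u))=H(u)\mu\ \text{ in }\Omega,\qquad u=0\ \text{ on }\partial\Omega .\tag{P}$$ Write $T_k(s)=\max(-k,\min(s,k))$. For $u$ measurable, positive and a.e. finite, $\nabla u$ denotes the measurable vector field with $\nabla T_k(u)=\nabla u\,\chi_{\{u\le k\}}$ for all $k>0$. In integrals with respect to $\mu_d$, the function $u$ and functions in $W^{1,p}_0(\Omega)$ are represented by their quasi continuous representatives (that of $u$ may a priori take the value $+\infty$), and $u$ is positive also $\mu_d$-a.e. A measurable, positive, a.e. finite function $u$ is a *renormalized solution* of (P) if $T_k(u)\in W^{1,p}_0(\Omega)$ for every $k>0$; if for all $S\in W^{1,\infty}(\mathbb R)$ with compact support and all $\varphi\in W^{1,p}_0(\Omega)\cap L^\infty(\Omega)$ one has $H(u)S(u)\varphi\in L^1(\Omega,\mu_d)$ and $$\int_\Omega a(x,\nabla u)\cdot\nabla\varphi\,S(u)+\int_\Omega a(x,\nabla u)\cdot\nabla u\,S'(u)\varphi=\int_\Omega H(u)S(u)\varphi\,d\mu_d$$ (with $S(u)=0$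 where $u=+\infty$); and if for all bounded continuous $\varphi:\Omega\to\mathbb R$ $$\lim_{t\to\infty}\frac1t\int_{\{t<u<2t\}}a(x,\nabla u)\cdot\nabla u\,\varphi=H(\infty)\int_\Omega\varphi\,d\mu_c .$$ A measurable, positive, a.e. finite function $u$ with $|\nabla u|^{p-1}\in L^1_{loc}(\Omega)$ is a *distributional solution* of (P) if its quasi continuous representative is finite $\mu_d$-a.e., $H(u)\in L^1_{loc}(\Omega,\mu_d)$, $T_k(u)^{\frac{\tau-1+p}{p}}\in W^{1,p}_0(\Omega)$ for every $k>0$, where $\tau=\max(1,\gamma)$, and $$\int_\Omega a(x,\nabla u)\cdot\nabla\varphi=\int_\Omega H(u)\varphi\,d\mu_d+H(\infty)\int_\Omega\varphi\,d\mu_c\qquad\text{for all }\varphi\in C^1_c(\Omega).$$ **Lemma.** If $\gamma\le1$, then every renormalized solution $u$ of (P) is also a distributional solution of (P). -/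

import Mathlib

open MeasureTheory Filter Topology
open scoped ENNReal

/-- Euclidean space `ℝ^N`. -/
abbrev RN (N : ℕ) : Type := EuclideanSpace ℝ (Fin N)

section Sobolev

variable {N : ℕ}

/-- `φ ∈ C^∞_c(Ω)`. -/
structure IsTestFunction (Ω : Set (RN N)) (φ : RN N → ℝ) : Prop where
  contDiff : ContDiff ℝ (⊤ : ℕ∞) φ
  hasCompactSupport : HasCompactSupport φ
  tsupport_subset : tsupport φ ⊆ Ω

/-- The vector field `g ∈ L^1_loc(Ω)^N` is the distributional gradient of `f ∈ L^1_loc(Ω)`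
in the open set `Ω`. -/
structure HasWeakGradient (Ω : Set (RN N)) (f : RN N → ℝ) (g : RN N → RN N) : Prop where
  locallyIntegrable : LocallyIntegrableOn f Ω volume
  locallyIntegrable_grad : LocallyIntegrableOn g Ω volume
  integral_eq : ∀ φ : RN N → ℝ, IsTestFunction Ω φ → ∀ e : RN N,
    ∫ x in Ω, f x * fderiv ℝ φ x e = - ∫ x in Ω, inner ℝ (g x) e * φ x

/-- `f ∈ W^{1,p}_0(Ω)` and `∇f = g`: the function `f` belongs to `W^{1,p}(Ω)`, with weak
gradient `g`, and is the limit in `W^{1,p}(Ω)` of a sequence in `C^∞_c(Ω)`. -/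
structure HasW0Gradient (Ω : Set (RN N)) (p : ℝ) (f : RN N → ℝ) (g : RN N → RN N) :
    Prop where
  memLp : MemLp f (ENNReal.ofReal p) (volume.restrict Ω)
  memLp_grad : MemLp g (ENNReal.ofReal p) (volume.restrict Ω)
  hasWeakGradient : HasWeakGradient Ω f g
  exists_approx : ∃ φ : ℕ → RN N → ℝ, (∀ n, IsTestFunction Ω (φ n)) ∧
    Tendsto (fun n => eLpNorm (fun x => φ n x - f x) (ENNReal.ofReal p) (volume.restrict Ω))
      atTop (𝓝 0) ∧
    Tendsto (fun n => eLpNorm (fun x => gradient (φ n) x - g x) (ENNReal.ofReal p)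
      (volume.restrict Ω)) atTop (𝓝 0)

/-- `f ∈ W^{1,p}_0(Ω)`. -/
def MemW0 (Ω : Set (RN N)) (p : ℝ) (f : RN N → ℝ) : Prop :=
  ∃ g : RN N → RN N, HasW0Gradient Ω p f g

/-- The `p`-capacity of `B ⊆ Ω`: the infimum of `∫_Ω |∇w|^p` over the `w ∈ W^{1,p}_0(Ω)` with
`w ≥ 1` almost everywhere in a neighbourhood of `B` (it is `∞` if there is no such `w`). -/
noncomputable def pCapacity (Ω : Set (RN N)) (p : ℝ) (B : Set (RN N)) : ℝ≥0∞ :=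
  sInf {c | ∃ (w : RN N → ℝ) (g : RN N → RN N) (U : Set (RN N)),
    HasW0Gradient Ω p w g ∧ IsOpen U ∧ B ⊆ U ∧
    (∀ᵐ x ∂(volume.restrict (U ∩ Ω)), 1 ≤ w x) ∧
    c = ∫⁻ x in Ω, ENNReal.ofReal (‖g x‖ ^ p)}

/-- `f` is quasi continuous in `Ω` with respect to the `p`-capacity. The values may lie in any
topological space, e.g. `ℝ` or `[0,∞]`. -/
def IsQuasiContinuous (Ω : Set (RN N)) (p : ℝ) {Y : Type*} [TopologicalSpace Y]
    (f : RN N → Y) : Prop :=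
  ∀ ε : ℝ≥0∞, 0 < ε → ∃ G : Set (RN N), IsOpen G ∧ G ⊆ Ω ∧ pCapacity Ω p G < ε ∧
    ContinuousOn f (Ω \ G)

/-- The decomposition `μ = μd + μc` of a nonnegative measure into its part `μd` that is diffuse
with respect to the `p`-capacity and its part `μc` that is concentrated on a Borel set of zero
`p`-capacity. -/
structure IsCapacityDecomposition (Ω : Set (RN N)) (p : ℝ) (μ μd μc : Measure (RN N)) :
    Prop where
  add_eq : μ = μd + μc
  diffuse : ∀ B : Set (RN N), MeasurableSet B → B ⊆ Ω → pCapacity Ω p B = 0 → μd B = 0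
  concentrated : ∃ Z : Set (RN N), MeasurableSet Z ∧ Z ⊆ Ω ∧ pCapacity Ω p Z = 0 ∧ μc Zᶜ = 0

end Sobolev

section Truncation

variable {N : ℕ}

/-- The truncation `T_k(s) = min(s,k)` of a nonnegative, possibly infinite value, for `k > 0`. -/
noncomputable def trunc (k : ℝ) (s : ℝ≥0∞) : ℝ := (min s (ENNReal.ofReal k)).toReal

/-- The value `S(s)` for a function `S : ℝ → ℝ` of compact support and `s ∈ [0,∞]`; it is `0`
at `s = ∞`. -/
noncomputable def evalCompact (S : ℝ → ℝ) (s : ℝ≥0∞) : ℝ := if s = ∞ then 0 else S s.toReal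

/-- `v` is the gradient of the nonnegative function `u`, all of whose truncations are weakly
differentiable: `∇T_k(u) = v χ_{u ≤ k}` for every `k > 0`. -/
structure IsTruncationGradient (Ω : Set (RN N)) (u : RN N → ℝ≥0∞) (v : RN N → RN N) :
    Prop where
  aestronglyMeasurable : AEStronglyMeasurable v (volume.restrict Ω)
  hasWeakGradient : ∀ k : ℝ, 0 < k →
    HasWeakGradient Ω (fun x => trunc k (u x)) ({x | u x ≤ ENNReal.ofReal k}.indicator v)

/-- `w` is a representative of `u` that is quasi continuous, with values in `[0,∞]`
(equivalently, all the truncations of `w` are quasi continuous). -/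
structure IsQuasiContinuousRep (Ω : Set (RN N)) (p : ℝ) (u w : RN N → ℝ≥0∞) : Prop where
  ae_eq : u =ᵐ[volume.restrict Ω] w
  quasiContinuous : IsQuasiContinuous Ω p w

end Truncation

section Problem

variable {N : ℕ}

/-- `a : Ω × ℝ^N → ℝ^N` is a Carathéodory function with the Leray-Lions structure conditions. -/
structure IsLerayLions (Ω : Set (RN N)) (p : ℝ) (a : RN N → RN N → RN N) : Prop where
  aemeasurable : ∀ ξ : RN N, AEMeasurable (fun x => a x ξ) (volume.restrict Ω)
  continuous : ∀ᵐ x ∂(volume.restrict Ω), Continuous (a x)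
  coercive : ∃ α : ℝ, 0 < α ∧ ∀ᵐ x ∂(volume.restrict Ω), ∀ ξ : RN N,
    α * ‖ξ‖ ^ p ≤ inner ℝ (a x ξ) ξ
  growth : ∃ β : ℝ, 0 < β ∧ ∀ᵐ x ∂(volume.restrict Ω), ∀ ξ : RN N,
    ‖a x ξ‖ ≤ β * ‖ξ‖ ^ (p - 1)
  monotone : ∀ᵐ x ∂(volume.restrict Ω), ∀ ξ ξ' : RN N, ξ ≠ ξ' →
    0 < inner ℝ (a x ξ - a x ξ') (ξ - ξ')

/-- `H : (0,∞) → (0,∞)` is continuous, has the finite limit `Hinf = H(∞)` at infinity, and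
`H(s) ≤ C / s^γ` for small `s`. Only the values of `H` on `(0,∞)` matter. -/
structure IsSingularNonlinearity (H : ℝ → ℝ) (Hinf γ : ℝ) : Prop where
  continuousOn : ContinuousOn H (Set.Ioi 0)
  pos : ∀ s : ℝ, 0 < s → 0 < H s
  tendsto : Tendsto H atTop (𝓝 Hinf)
  gamma_nonneg : 0 ≤ γ
  bound : ∃ C s₀ : ℝ, 0 < C ∧ 0 < s₀ ∧ ∀ s : ℝ, 0 < s → s < s₀ → H s ≤ C / s ^ γ

/-- `u` is a renormalized solution of `-div(a(x,∇u)) = H(u)μ` in `Ω`, `u = 0` on `∂Ω`, where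
`μ = μd + μc`. Here `v` is the gradient of `u` and `w` its quasi continuous representative,
which is the one that enters the integrals with respect to `μd`; likewise the test functions
`φ ∈ W^{1,p}_0(Ω) ∩ L^∞(Ω)` run over quasi continuous representatives. The positivity of `u`
is understood also `μd`-almost everywhere, where `H(u)` is integrated. The functions in
`W^{1,∞}(ℝ)` with compact support are the Lipschitz ones with compact support; as `v = 0` almost
everywhere on `{u ∈ E}` for a null set `E ⊆ ℝ`, the values of `deriv S` where `S` is not
differentiable play no role. -/
def IsRenormalizedSolution (Ω : Set (RN N)) (p : ℝ) (a : RN N → RN N → RN N)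
    (μd μc : Measure (RN N)) (H : ℝ → ℝ) (Hinf : ℝ) (u : RN N → ℝ≥0∞) : Prop :=
  AEMeasurable u (volume.restrict Ω) ∧
  (∀ᵐ x ∂(volume.restrict Ω), 0 < u x ∧ u x < ∞) ∧
  (∀ k : ℝ, 0 < k → MemW0 Ω p (fun x => trunc k (u x))) ∧
  ∃ (v : RN N → RN N) (w : RN N → ℝ≥0∞),
    IsTruncationGradient Ω u v ∧
    IsQuasiContinuousRep Ω p u w ∧
    (∀ᵐ x ∂(μd.restrict Ω), 0 < w x) ∧
    (∀ S : ℝ → ℝ, (∃ K, LipschitzWith K S) → HasCompactSupport S →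
      ∀ (φ : RN N → ℝ) (g : RN N → RN N), HasW0Gradient Ω p φ g →
        MemLp φ ∞ (volume.restrict Ω) → IsQuasiContinuous Ω p φ →
        IntegrableOn (fun x => H (w x).toReal * evalCompact S (w x) * φ x) Ω μd ∧
        (∫ x in Ω, inner ℝ (a x (v x)) (g x) * evalCompact S (u x)) +
            ∫ x in Ω, inner ℝ (a x (v x)) (v x) * evalCompact (deriv S) (u x) * φ x =
          ∫ x in Ω, H (w x).toReal * evalCompact S (w x) * φ x ∂μd) ∧
    (∀ φ : RN N → ℝ, ContinuousOn φ Ω → (∃ M : ℝ, ∀ x ∈ Ω, |φ x| ≤ M) →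
      Tendsto (fun t : ℝ => (1 / t) *
          ∫ x in {x | x ∈ Ω ∧ ENNReal.ofReal t < u x ∧ u x < ENNReal.ofReal (2 * t)},
            inner ℝ (a x (v x)) (v x) * φ x)
        atTop (𝓝 (Hinf * ∫ x in Ω, φ x ∂μc)))

/-- `u` is a distributional solution of `-div(a(x,∇u)) = H(u)μ` in `Ω`, `u = 0` on `∂Ω`, where
`μ = μd + μc` and `H` has growth exponent `γ` at the origin. Again `v` is the gradient of `u`,
and `w` its quasi continuous representative, which has values in the domain `(0,∞)` of `H`
almost everywhere with respect to `μd`. -/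
def IsDistributionalSolution (Ω : Set (RN N)) (p : ℝ) (a : RN N → RN N → RN N)
    (μd μc : Measure (RN N)) (H : ℝ → ℝ) (Hinf γ : ℝ) (u : RN N → ℝ≥0∞) : Prop :=
  AEMeasurable u (volume.restrict Ω) ∧
  (∀ᵐ x ∂(volume.restrict Ω), 0 < u x ∧ u x < ∞) ∧
  (∀ k : ℝ, 0 < k → MemW0 Ω p (fun x => trunc k (u x) ^ ((max 1 γ - 1 + p) / p))) ∧
  ∃ (v : RN N → RN N) (w : RN N → ℝ≥0∞),
    IsTruncationGradient Ω u v ∧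
    LocallyIntegrableOn (fun x => ‖v x‖ ^ (p - 1)) Ω volume ∧
    IsQuasiContinuousRep Ω p u w ∧
    (∀ᵐ x ∂(μd.restrict Ω), 0 < w x ∧ w x < ∞) ∧
    LocallyIntegrableOn (fun x => H (w x).toReal) Ω μd ∧
    (∀ φ : RN N → ℝ, ContDiff ℝ 1 φ → HasCompactSupport φ → tsupport φ ⊆ Ω →
      ∫ x in Ω, inner ℝ (a x (v x)) (gradient φ x) =
        (∫ x in Ω, H (w x).toReal * φ x ∂μd) + Hinf * ∫ x in Ω, φ x ∂μc)

end Problem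

/-! Insert in the renormalized equation a cutoff `S = cutoff t`, equal to `1` on `[-t,t]` and to `0`
off `[-2t,2t]`, and a test function `φ ∈ C¹_c(Ω)`. Since `S' = -1/t` on `(t,2t)`, the term with `S'`
is exactly minus the mean of the flux over `{t < u < 2t}`, which tends to `-H(∞) ∫ φ dμc` by the
definition of a renormalized solution. As `t → ∞` the two other terms should tend to `∫ a(x,∇u)·∇φ`
and `∫ H(u) φ dμd`, which is the distributional equation.

Three facts justify this limit. The first two come from the linear energy growth `∫_{u ≤ k} |∇u|^p ≤
C k`: the flux condition with `φ = 1` and coercivity give `O(t)` on each band `{t < u < 2t}`, and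
the bands sum like a geometric series (`exists_energy_bound`).

(1) `|∇u|^{p-1}` is integrable (`lintegral_grad_rpow_lt_top`). Sobolev's inequality for `T_k(u)`
makes the measure of `{u ≥ k}` decay like `k^{-N(p-1)/(N-p)}`, and Hölder's inequality on dyadic
bands of `u` yields a convergent geometric series.

(2) The quasi continuous representative `w` is finite `μd`-a.e.
(`exists_measurableSet_pCapacity_eq_zero`). Up to a small exceptional set, `T_k(u)/k` is a
competitor for the capacity of `{w > k}`, with energy at most `C k^{1-p} → 0`. Hence `{w = ∞}` lies
in a Borel set of zero capacity, which `μd` does not charge.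

(3) `H(u)` is locally `μd`-integrable (`integrableOn_diffuse_of_tendsto`). For `φ ≥ 0` the
integrands `H(u) S(u) φ` are nonnegative and their integrals converge, because the other terms of
the equation do; Fatou's lemma applies.

Finally, `γ ≤ 1` means `τ = 1`, so the power of `T_k(u)` required to be in `W^{1,p}_0(Ω)` is
`T_k(u)` itself. -/

/-! ### Test functions and closedness of `W^{1,p}_0(Ω)`. -/

section SobolevSpace

variable {N : ℕ} {Ω : Set (RN N)} {p : ℝ}

theorem isFiniteMeasure_restrict_of_isBounded (hΩb : Bornology.IsBounded Ω) :
    IsFiniteMeasure (volume.restrict Ω) :=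
  isFiniteMeasure_restrict.2 hΩb.measure_lt_top.ne

theorem continuous_gradient_of_contDiff {f : RN N → ℝ} (hf : ContDiff ℝ 1 f) :
    Continuous (gradient f) :=
  (InnerProductSpace.toDual ℝ (RN N)).symm.continuous.comp (hf.continuous_fderiv one_ne_zero)

theorem hasCompactSupport_gradient {f : RN N → ℝ} (hf : HasCompactSupport f) :
    HasCompactSupport (gradient f) :=
  (hf.fderiv ℝ).comp_left (g := (InnerProductSpace.toDual ℝ (RN N)).symm) (map_zero _)

theorem norm_gradient_eq {f : RN N → ℝ} (x : RN N) : ‖gradient f x‖ = ‖fderiv ℝ f x‖ :=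
  (InnerProductSpace.toDual ℝ (RN N)).symm.norm_map _

theorem norm_gradient_sub {f g : RN N → ℝ} (x : RN N) :
    ‖gradient f x - gradient g x‖ = ‖fderiv ℝ f x - fderiv ℝ g x‖ := by
  rw [gradient, gradient, ← map_sub]
  exact (InnerProductSpace.toDual ℝ (RN N)).symm.norm_map _

/-- The gradient of a `C¹` function is its weak gradient. -/
theorem hasWeakGradient_of_contDiff {f : RN N → ℝ} (hf : ContDiff ℝ 1 f) :
    HasWeakGradient Ω f (gradient f) where
  locallyIntegrable := hf.continuous.locallyIntegrable.locallyIntegrableOn Ω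
  locallyIntegrable_grad := (continuous_gradient_of_contDiff hf).locallyIntegrable.locallyIntegrableOn Ω
  integral_eq φ hφ e := by
    have hφ1 : ContDiff ℝ 1 φ := hφ.contDiff.of_le (by exact_mod_cast le_top)
    have hcφ := hφ1.continuous_fderiv one_ne_zero
    have hcf := hf.continuous_fderiv one_ne_zero
    rw [setIntegral_eq_integral_of_forall_compl_eq_zero,
      setIntegral_eq_integral_of_forall_compl_eq_zero]
    · simp only [inner_gradient_left]
      apply integral_mul_fderiv_eq_neg_fderiv_mul_of_integrable
      · apply Continuous.integrable_of_hasCompactSupport (by fun_prop)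
        exact hφ.hasCompactSupport.mul_left
      · apply Continuous.integrable_of_hasCompactSupport (by fun_prop)
        exact (hφ.hasCompactSupport.fderiv_apply (𝕜 := ℝ) e).mul_left
      · apply Continuous.integrable_of_hasCompactSupport (by fun_prop)
        exact hφ.hasCompactSupport.mul_left
      · exact fun x _ => (hf.differentiable one_ne_zero) x
      · exact fun x _ => (hφ1.differentiable one_ne_zero) x
    · intro x hx
      rw [image_eq_zero_of_notMem_tsupport (fun h => hx (hφ.tsupport_subset h)), mul_zero]
    · intro x hx
      rw [fderiv_of_notMem_tsupport (𝕜 := ℝ) (fun h => hx (hφ.tsupport_subset h))]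
      simp

/-- Mollification of a `C¹` function with compact support. -/
theorem exists_isTestFunction_near (hΩ : IsOpen Ω) {φ : RN N → ℝ} (hφ : ContDiff ℝ 1 φ)
    (hφc : HasCompactSupport φ) (hφΩ : tsupport φ ⊆ Ω) {ε : ℝ} (hε : 0 < ε) :
    ∃ ψ : RN N → ℝ, IsTestFunction Ω ψ ∧ (∀ x, |ψ x - φ x| ≤ ε) ∧
      ∀ x, ‖gradient ψ x - gradient φ x‖ ≤ ε := by
  obtain ⟨δ₀, hδ₀, hsub⟩ := hφc.isCompact.exists_cthickening_subset_open hΩ hφΩ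
  have hcont := hφ.continuous
  have hcont' := hφ.continuous_fderiv one_ne_zero
  obtain ⟨δ₁, hδ₁, h₁⟩ := Metric.uniformContinuous_iff.1
    (hφc.uniformContinuous_of_continuous hcont) ε hε
  obtain ⟨δ₂, hδ₂, h₂⟩ := Metric.uniformContinuous_iff.1
    ((hφc.fderiv ℝ).uniformContinuous_of_continuous hcont') ε hε
  -- `δ₀` keeps the support of the mollification in `Ω`; `δ₁` and `δ₂` are moduli of uniform
  -- continuity for `φ` and for its derivative.
  set δ := min δ₀ (min δ₁ δ₂) with hδdef
  have hδ : 0 < δ := by positivity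
  let b : ContDiffBump (0 : RN N) := ⟨δ / 2, δ, by positivity, by linarith⟩
  let ρ := b.normed volume
  let ψ := convolution ρ φ (ContinuousLinearMap.lsmul ℝ ℝ) volume
  have hρsupp : Function.support ρ ⊆ Metric.ball 0 δ := (b.support_normed_eq (μ := volume)).subset
  have hρcont : Continuous ρ := b.continuous_normed
  have hfd : ∀ x, HasFDerivAt ψ
      (convolution ρ (fderiv ℝ φ) (ContinuousLinearMap.lsmul ℝ ℝ) volume x) x := by
    intro x
    have h := hφc.hasFDerivAt_convolution_right (μ := volume) (ContinuousLinearMap.lsmul ℝ ℝ)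
      (hρcont.locallyIntegrable (μ := volume)) hφ x
    convert! h using 1
  have hsupp : tsupport ψ ⊆ Ω := by
    refine subset_trans ?_ hsub
    refine closure_minimal ?_ Metric.isClosed_cthickening
    intro x hx
    obtain ⟨y, hy, z, hz, rfl⟩ := support_convolution_subset
      (ContinuousLinearMap.lsmul ℝ ℝ) (μ := volume) hx
    have hy' := hρsupp hy
    refine Metric.mem_cthickening_of_dist_le _ z _ _ (subset_tsupport _ hz) ?_
    rw [dist_eq_norm]
    simp only [Metric.mem_ball, dist_zero_right] at hy'
    simpa using hy'.le.trans (min_le_left _ _)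
  refine ⟨ψ, ⟨?_, ?_, hsupp⟩, ?_, ?_⟩
  · exact (b.hasCompactSupport_normed (μ := volume)).contDiff_convolution_left _
      b.contDiff_normed hcont.locallyIntegrable
  · exact HasCompactSupport.convolution _ b.hasCompactSupport_normed hφc
  · intro x
    rw [← Real.dist_eq]
    refine dist_convolution_le hε.le hρsupp (fun x => b.nonneg_normed x) b.integral_normed
      hcont.aestronglyMeasurable ?_
    intro y hy
    exact (h₁ (lt_of_lt_of_le hy ((min_le_right _ _).trans (min_le_left _ _)))).le
  · intro x
    rw [norm_gradient_sub, (hfd x).fderiv, ← dist_eq_norm]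
    refine dist_convolution_le hε.le hρsupp (fun x => b.nonneg_normed x) b.integral_normed
      hcont'.aestronglyMeasurable ?_
    intro y hy
    exact (h₂ (lt_of_lt_of_le hy ((min_le_right _ _).trans (min_le_right _ _)))).le

theorem tendsto_eLpNorm_of_bound {α E : Type*} [MeasurableSpace α] [NormedAddCommGroup E]
    {μ : Measure α} [IsFiniteMeasure μ] {q : ℝ≥0∞} {F : ℕ → α → E}
    (h : ∀ n x, ‖F n x‖ ≤ 1 / ((n : ℝ) + 1)) :
    Tendsto (fun n => eLpNorm (F n) q μ) atTop (𝓝 0) := by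
  have h0 : Tendsto (fun n : ℕ => μ Set.univ ^ q.toReal⁻¹ * ENNReal.ofReal (1 / ((n : ℝ) + 1)))
      atTop (𝓝 0) := by
    have h1 := ENNReal.tendsto_ofReal (tendsto_one_div_add_atTop_nhds_zero_nat (𝕜 := ℝ))
    have h2 := ENNReal.Tendsto.const_mul (a := μ Set.univ ^ q.toReal⁻¹) h1
      (Or.inr (ENNReal.rpow_ne_top_of_nonneg (by positivity) (measure_ne_top _ _)))
    simpa using h2
  exact tendsto_of_tendsto_of_tendsto_of_le_of_le tendsto_const_nhds h0 (fun _ => zero_le)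
    (fun n => eLpNorm_le_of_ae_bound (.of_forall (h n)))

/-- `C¹_c(Ω) ⊆ W^{1,p}_0(Ω)`. -/
theorem hasW0Gradient_of_contDiff (hΩ : IsOpen Ω) (hΩb : Bornology.IsBounded Ω) {φ : RN N → ℝ}
    (hφ : ContDiff ℝ 1 φ) (hφc : HasCompactSupport φ) (hφΩ : tsupport φ ⊆ Ω) :
    HasW0Gradient Ω p φ (gradient φ) := by
  have := isFiniteMeasure_restrict_of_isBounded hΩb
  refine ⟨?_, ?_, hasWeakGradient_of_contDiff hφ, ?_⟩
  · exact (hφ.continuous.memLp_of_hasCompactSupport hφc).restrict _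
  · exact ((continuous_gradient_of_contDiff hφ).memLp_of_hasCompactSupport
      (hasCompactSupport_gradient hφc)).restrict _
  · choose ψ hψ h1 h2 using fun n : ℕ =>
      exists_isTestFunction_near hΩ hφ hφc hφΩ (ε := 1 / ((n : ℝ) + 1)) (by positivity)
    exact ⟨ψ, hψ, tendsto_eLpNorm_of_bound h1, tendsto_eLpNorm_of_bound h2⟩

theorem IsTestFunction.contDiff_one {φ : RN N → ℝ} (hφ : IsTestFunction Ω φ) :
    ContDiff ℝ 1 φ := hφ.contDiff.of_le (by exact_mod_cast le_top)

theorem IsTestFunction.hasW0Gradient (hΩ : IsOpen Ω) (hΩb : Bornology.IsBounded Ω) {φ : RN N → ℝ}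
    (hφ : IsTestFunction Ω φ) : HasW0Gradient Ω p φ (gradient φ) :=
  hasW0Gradient_of_contDiff hΩ hΩb hφ.contDiff_one hφ.hasCompactSupport hφ.tsupport_subset

/-- On a finite measure space `L^q` convergence implies `L¹` convergence, and `B` is additive and
bounded in its first argument. Taking for `B` a product with a test function or with one of its
derivatives, this passes to the limit on either side of the weak gradient identity. -/
theorem tendsto_setIntegral_of_tendsto_eLpNorm {α : Type*} [MeasurableSpace α] {μ : Measure α}
    [IsFiniteMeasure μ] {q : ℝ≥0∞} (hq : 1 ≤ q) {E : Type*} [NormedAddCommGroup E]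
    {F : ℕ → α → E} {f : α → E} (hF : ∀ n, MemLp (F n) q μ) (hf : MemLp f q μ)
    (h : Tendsto (fun n => eLpNorm (F n - f) q μ) atTop (𝓝 0)) {B : E → α → ℝ} {C : ℝ}
    (hB : ∀ e x, |B e x| ≤ C * ‖e‖) (hBs : ∀ e e' x, B (e - e') x = B e x - B e' x)
    (hBm : ∀ G : α → E, AEStronglyMeasurable G μ → AEStronglyMeasurable (fun x => B (G x) x) μ) :
    Tendsto (fun n => ∫ x, B (F n x) x ∂μ) atTop (𝓝 (∫ x, B (f x) x ∂μ)) := by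
  have hint : ∀ G : α → E, MemLp G q μ → Integrable (fun x => B (G x) x) μ := fun G hG =>
    Integrable.mono' ((hG.integrable hq).norm.const_mul C) (hBm G hG.1)
      (.of_forall fun x => hB _ _)
  refine tendsto_integral_of_L1' _ (hint f hf).1 (.of_forall fun n => hint _ (hF n)) ?_
  have hle : ∀ n, eLpNorm ((fun x => B (F n x) x) - fun x => B (f x) x) 1 μ ≤
      ENNReal.ofReal C * (eLpNorm (F n - f) q μ * μ Set.univ ^ (1 - 1 / q.toReal)) := by
    intro n
    calc _ ≤ ENNReal.ofReal C * eLpNorm (F n - f) 1 μ := by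
            refine eLpNorm_le_mul_eLpNorm_of_ae_le_mul (.of_forall fun x => ?_) 1
            simp only [Pi.sub_apply, ← hBs]
            exact hB _ _
      _ ≤ _ := by
            gcongr
            simpa using eLpNorm_le_eLpNorm_mul_rpow_measure_univ hq ((hF n).1.sub hf.1)
  refine tendsto_of_tendsto_of_tendsto_of_le_of_le tendsto_const_nhds ?_ (fun _ => zero_le) hle
  have hexp : (0 : ℝ) ≤ 1 - 1 / q.toReal := by
    rcases eq_or_ne q ⊤ with rfl | hqt
    · simp
    · have : 1 ≤ q.toReal := by
        simpa using (ENNReal.toReal_le_toReal ENNReal.one_ne_top hqt).2 hq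
      rw [sub_nonneg, div_le_one (by linarith)]; exact this
  have h3 := ENNReal.Tendsto.const_mul (a := ENNReal.ofReal C) (ENNReal.Tendsto.mul_const
    (b := μ Set.univ ^ (1 - 1 / q.toReal)) h
    (Or.inr (ENNReal.rpow_ne_top_of_nonneg hexp (measure_ne_top _ _)))) (Or.inr ENNReal.ofReal_ne_top)
  simpa using h3

/-- `W^{1,p}_0(Ω)` is closed. -/
theorem HasW0Gradient.of_tendsto (hΩb : Bornology.IsBounded Ω) (hp : 1 < p)
    {f : ℕ → RN N → ℝ} {g : ℕ → RN N → RN N} {f₀ : RN N → ℝ} {g₀ : RN N → RN N}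
    (hfg : ∀ n, HasW0Gradient Ω p (f n) (g n))
    (hf₀ : MemLp f₀ (ENNReal.ofReal p) (volume.restrict Ω))
    (hg₀ : MemLp g₀ (ENNReal.ofReal p) (volume.restrict Ω))
    (hf : Tendsto (fun n => eLpNorm (f n - f₀) (ENNReal.ofReal p) (volume.restrict Ω)) atTop (𝓝 0))
    (hg : Tendsto (fun n => eLpNorm (g n - g₀) (ENNReal.ofReal p) (volume.restrict Ω)) atTop
      (𝓝 0)) :
    HasW0Gradient Ω p f₀ g₀ := by
  have := isFiniteMeasure_restrict_of_isBounded hΩb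
  have hq : 1 ≤ ENNReal.ofReal p := ENNReal.one_le_ofReal.2 hp.le
  refine ⟨hf₀, hg₀, ⟨?_, ?_, ?_⟩, ?_⟩
  · exact locallyIntegrableOn_of_locallyIntegrable_restrict (hf₀.locallyIntegrable hq)
  · exact locallyIntegrableOn_of_locallyIntegrable_restrict (hg₀.locallyIntegrable hq)
  · intro φ hφ e
    have hcφ := hφ.contDiff.continuous
    have hcφ' := hφ.contDiff_one.continuous_fderiv one_ne_zero
    obtain ⟨C₁, hC₁⟩ := (hcφ'.clm_apply (continuous_const (y := e))).bounded_above_of_compact_support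
      (hφ.hasCompactSupport.fderiv_apply (𝕜 := ℝ) e)
    obtain ⟨C₂, hC₂⟩ := hcφ.bounded_above_of_compact_support hφ.hasCompactSupport
    have h1 : Tendsto (fun n => ∫ x in Ω, f n x * fderiv ℝ φ x e) atTop
        (𝓝 (∫ x in Ω, f₀ x * fderiv ℝ φ x e)) := by
      refine tendsto_setIntegral_of_tendsto_eLpNorm hq (fun n => (hfg n).memLp) hf₀ hf
        (B := fun y x => y * fderiv ℝ φ x e) (C := C₁) ?_ ?_ ?_
      · intro y x
        rw [abs_mul, mul_comm]
        exact mul_le_mul_of_nonneg_right (hC₁ x) (abs_nonneg _)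
      · intros; ring
      · intro G hG
        exact hG.mul (hcφ'.clm_apply continuous_const).aestronglyMeasurable
    have h2 : Tendsto (fun n => ∫ x in Ω, inner ℝ (g n x) e * φ x) atTop
        (𝓝 (∫ x in Ω, inner ℝ (g₀ x) e * φ x)) := by
      refine tendsto_setIntegral_of_tendsto_eLpNorm hq (fun n => (hfg n).memLp_grad) hg₀ hg
        (B := fun y x => inner ℝ y e * φ x) (C := ‖e‖ * C₂) ?_ ?_ ?_
      · intro y x
        rw [abs_mul]
        have := abs_real_inner_le_norm y e
        have h3 := hC₂ x
        rw [Real.norm_eq_abs] at h3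
        calc _ ≤ (‖y‖ * ‖e‖) * C₂ := by gcongr
          _ = _ := by ring
      · intros; rw [inner_sub_left]; ring
      · intro G hG
        exact (hG.inner_const).mul hcφ.aestronglyMeasurable
    have h3 := h2.neg
    refine tendsto_nhds_unique h1 (h3.congr fun n => ?_)
    exact ((hfg n).hasWeakGradient.integral_eq φ hφ e).symm
  -- Diagonal choice: a test function within `1/(n+1)` of the `n`-th term, for the function and for
  -- its gradient.
  · have key : ∀ n : ℕ, ∃ ψ : RN N → ℝ, IsTestFunction Ω ψ ∧
        eLpNorm (fun x => ψ x - f n x) (ENNReal.ofReal p) (volume.restrict Ω) ≤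
          ENNReal.ofReal (1 / ((n : ℝ) + 1)) ∧
        eLpNorm (fun x => gradient ψ x - g n x) (ENNReal.ofReal p) (volume.restrict Ω) ≤
          ENNReal.ofReal (1 / ((n : ℝ) + 1)) := by
      intro n
      obtain ⟨ψ, hψ, h1, h2⟩ := (hfg n).exists_approx
      have hpos : 0 < ENNReal.ofReal (1 / ((n : ℝ) + 1)) := by
        rw [ENNReal.ofReal_pos]; positivity
      obtain ⟨m, hm1, hm2⟩ := ((ENNReal.tendsto_nhds_zero.1 h1 _ hpos).and
        (ENNReal.tendsto_nhds_zero.1 h2 _ hpos)).exists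
      exact ⟨ψ m, hψ m, hm1, hm2⟩
    choose ψ hψ h1 h2 using key
    have h0 : Tendsto (fun n : ℕ => ENNReal.ofReal (1 / ((n : ℝ) + 1))) atTop (𝓝 0) := by
      simpa using ENNReal.tendsto_ofReal (tendsto_one_div_add_atTop_nhds_zero_nat (𝕜 := ℝ))
    refine ⟨ψ, hψ, ?_, ?_⟩
    · refine tendsto_of_tendsto_of_tendsto_of_le_of_le tendsto_const_nhds
        (add_zero (0 : ℝ≥0∞) ▸ h0.add hf) (fun _ => zero_le) fun n => ?_
      have h3 : (fun x => ψ n x - f₀ x) = (fun x => ψ n x - f n x) + (f n - f₀) := by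
        ext x; simp
      rw [h3]
      refine (eLpNorm_add_le ((hψ n).contDiff.continuous.aestronglyMeasurable.sub (hfg n).memLp.1)
        ((hfg n).memLp.1.sub hf₀.1) hq).trans ?_
      exact add_le_add_left (h1 n) _
    · refine tendsto_of_tendsto_of_tendsto_of_le_of_le tendsto_const_nhds
        (add_zero (0 : ℝ≥0∞) ▸ h0.add hg) (fun _ => zero_le) fun n => ?_
      have h3 : (fun x => gradient (ψ n) x - g₀ x) =
          (fun x => gradient (ψ n) x - g n x) + (g n - g₀) := by
        ext x; simp
      rw [h3]
      refine (eLpNorm_add_le ((continuous_gradient_of_contDiff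
        (hψ n).contDiff_one).aestronglyMeasurable.sub (hfg n).memLp_grad.1)
        ((hfg n).memLp_grad.1.sub hg₀.1) hq).trans ?_
      exact add_le_add_left (h2 n) _

end SobolevSpace

/-! ### Chain rule, sums, uniqueness of gradients and Sobolev's inequality in `W^{1,p}_0(Ω)`. -/

section SobolevCalculus

variable {N : ℕ} {Ω : Set (RN N)} {p : ℝ}

theorem tendsto_eLpNorm_zero_of_dominated {α E F : Type*} [MeasurableSpace α] {μ : Measure α}
    [NormedAddCommGroup E] [NormedAddCommGroup F] {q : ℝ≥0∞} (hq0 : q ≠ 0) (hqt : q ≠ ⊤)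
    {f : ℕ → α → E} {b : α → F} (hf : ∀ n, AEStronglyMeasurable (f n) μ) (hb : MemLp b q μ)
    (hle : ∀ n, ∀ᵐ x ∂μ, ‖f n x‖ ≤ ‖b x‖)
    (hlim : ∀ᵐ x ∂μ, Tendsto (fun n => f n x) atTop (𝓝 0)) :
    Tendsto (fun n => eLpNorm (f n) q μ) atTop (𝓝 0) := by
  have hq : 0 < q.toReal := ENNReal.toReal_pos hq0 hqt
  have h1 : Tendsto (fun n => ∫⁻ x, ‖f n x‖ₑ ^ q.toReal ∂μ) atTop (𝓝 (∫⁻ _, 0 ∂μ)) := by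
    refine tendsto_lintegral_of_dominated_convergence' (fun x => ‖b x‖ₑ ^ q.toReal)
      (fun n => (hf n).enorm.pow_const _) (fun n => ?_) ?_ ?_
    · filter_upwards [hle n] with x hx
      exact ENNReal.rpow_le_rpow (enorm_le_iff_norm_le.2 hx) hq.le
    · exact (lintegral_rpow_enorm_lt_top_of_eLpNorm_lt_top hq0 hqt hb.2).ne
    · filter_upwards [hlim] with x hx
      have h2 : Tendsto (fun n => ‖f n x‖ₑ) atTop (𝓝 0) := by simpa using hx.enorm
      simpa [ENNReal.zero_rpow_of_pos hq] using h2.ennrpow_const q.toReal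
  rw [lintegral_zero] at h1
  simp_rw [eLpNorm_eq_lintegral_rpow_enorm_toReal hq0 hqt]
  simpa [ENNReal.zero_rpow_of_pos (inv_pos.2 hq)] using h1.ennrpow_const (1 / q.toReal)

theorem IsTestFunction.comp_smooth {φ : RN N → ℝ} (hφ : IsTestFunction Ω φ) {h : ℝ → ℝ}
    (hh : ContDiff ℝ (⊤ : ℕ∞) h) (h0 : h 0 = 0) : IsTestFunction Ω (h ∘ φ) where
  contDiff := hh.comp hφ.contDiff
  hasCompactSupport := hφ.hasCompactSupport.comp_left h0
  tsupport_subset := (closure_mono (Function.support_comp_subset h0 φ)).trans hφ.tsupport_subset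

theorem gradient_comp {φ : RN N → ℝ} {h : ℝ → ℝ} {x : RN N} (hh : DifferentiableAt ℝ h (φ x))
    (hφ : DifferentiableAt ℝ φ x) : gradient (h ∘ φ) x = deriv h (φ x) • gradient φ x := by
  rw [gradient, gradient, (hh.hasDerivAt.comp_hasFDerivAt x hφ.hasFDerivAt).fderiv, map_smul]

/-- Functions in `W^{1,p}_0(Ω)` are limits of test functions that converge almost everywhere. -/
theorem HasW0Gradient.exists_approx_ae (hp : 1 < p) {f : RN N → ℝ} {g : RN N → RN N}
    (hf : HasW0Gradient Ω p f g) :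
    ∃ φ : ℕ → RN N → ℝ, (∀ n, IsTestFunction Ω (φ n)) ∧
    Tendsto (fun n => eLpNorm (φ n - f) (ENNReal.ofReal p) (volume.restrict Ω)) atTop (𝓝 0) ∧
    Tendsto (fun n => eLpNorm (gradient (φ n) - g) (ENNReal.ofReal p) (volume.restrict Ω)) atTop
      (𝓝 0) ∧
    ∀ᵐ x ∂(volume.restrict Ω), Tendsto (fun n => φ n x) atTop (𝓝 (f x)) := by
  obtain ⟨φ, hφ, h1, h2⟩ := hf.exists_approx
  have hq0 : ENNReal.ofReal p ≠ 0 := by simp; linarith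
  obtain ⟨ns, hns, hae⟩ := (tendstoInMeasure_of_tendsto_eLpNorm hq0
    (fun n => (hφ n).contDiff.continuous.aestronglyMeasurable) hf.memLp.1 h1).exists_seq_tendsto_ae
  exact ⟨fun n => φ (ns n), fun n => hφ _, h1.comp hns.tendsto_atTop, h2.comp hns.tendsto_atTop,
    hae⟩

/-- The chain rule in `W^{1,p}_0(Ω)`. -/
theorem HasW0Gradient.comp_smooth (hΩ : IsOpen Ω) (hΩb : Bornology.IsBounded Ω) (hp : 1 < p)
    {f : RN N → ℝ} {g : RN N → RN N} (hf : HasW0Gradient Ω p f g) {h : ℝ → ℝ}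
    (hh : ContDiff ℝ (⊤ : ℕ∞) h) (h0 : h 0 = 0) {L : ℝ} (hL : ∀ s, |deriv h s| ≤ L) :
    HasW0Gradient Ω p (h ∘ f) (fun x => deriv h (f x) • g x) := by
  obtain ⟨φ, hφ, h1, h2, hae⟩ := hf.exists_approx_ae hp
  have hq0 : ENNReal.ofReal p ≠ 0 := by simp; linarith
  have hq : 1 ≤ ENNReal.ofReal p := ENNReal.one_le_ofReal.2 hp.le
  have hL0 : 0 ≤ L := (abs_nonneg _).trans (hL 0)
  have hh1 : ContDiff ℝ 1 h := hh.of_le (by exact_mod_cast le_top)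
  have hd : Continuous (deriv h) := hh1.continuous_deriv le_rfl
  have hlip : ∀ s t, |h s - h t| ≤ L * |s - t| := fun s t =>
    Convex.norm_image_sub_le_of_norm_deriv_le (s := Set.univ) (f := h) (C := L)
      (fun x _ => (hh1.differentiable one_ne_zero) x) (fun x _ => hL x) convex_univ
      (Set.mem_univ t) (Set.mem_univ s)
  have hdf : AEStronglyMeasurable (fun x => deriv h (f x)) (volume.restrict Ω) :=
    hd.comp_aestronglyMeasurable hf.memLp.1
  have hdφ : ∀ n, AEStronglyMeasurable (fun x => deriv h (φ n x)) (volume.restrict Ω) :=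
    fun n => (hd.comp (hφ n).contDiff.continuous).aestronglyMeasurable
  have hgφ : ∀ n, AEStronglyMeasurable (gradient (φ n)) (volume.restrict Ω) := fun n =>
    (continuous_gradient_of_contDiff (hφ n).contDiff_one).aestronglyMeasurable
  have hgrad : ∀ n, gradient (h ∘ φ n) = fun x => deriv h (φ n x) • gradient (φ n) x := by
    intro n
    ext1 x
    exact gradient_comp ((hh1.differentiable one_ne_zero) _)
      (((hφ n).contDiff_one.differentiable one_ne_zero) x)
  refine HasW0Gradient.of_tendsto hΩb hp
    (fun n => ((hφ n).comp_smooth hh h0).hasW0Gradient hΩ hΩb) ?_ ?_ ?_ ?_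
  · refine MemLp.of_le_mul (c := L) hf.memLp
      (hh.continuous.comp_aestronglyMeasurable hf.memLp.1) (.of_forall fun x => ?_)
    simpa [h0] using hlip (f x) 0
  · refine MemLp.of_le_mul (c := L) hf.memLp_grad (hdf.smul hf.memLp_grad.1)
      (.of_forall fun x => ?_)
    rw [norm_smul]
    exact mul_le_mul_of_nonneg_right (hL _) (norm_nonneg _)
  · have h3 : Tendsto (fun n => ENNReal.ofReal L *
        eLpNorm (φ n - f) (ENNReal.ofReal p) (volume.restrict Ω)) atTop (𝓝 0) := by
      simpa using ENNReal.Tendsto.const_mul h1 (Or.inr (ENNReal.ofReal_ne_top (r := L)))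
    refine tendsto_of_tendsto_of_tendsto_of_le_of_le tendsto_const_nhds h3 (fun _ => zero_le)
      fun n => ?_
    exact eLpNorm_le_mul_eLpNorm_of_ae_le_mul (.of_forall fun x => hlip _ _) _
  -- The difference of the gradients is `h'(φₙ)(∇φₙ - g) + (h'(φₙ) - h'(f)) g`. The first summand is
  -- bounded by `L|∇φₙ - g|`; the second tends to zero a.e. and is dominated by `2L|g|`.
  · have h3 : Tendsto (fun n => ENNReal.ofReal L *
        eLpNorm (gradient (φ n) - g) (ENNReal.ofReal p) (volume.restrict Ω)) atTop (𝓝 0) := by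
      simpa using ENNReal.Tendsto.const_mul h2 (Or.inr (ENNReal.ofReal_ne_top (r := L)))
    have h4 : Tendsto (fun n => eLpNorm (fun x => (deriv h (φ n x) - deriv h (f x)) • g x)
        (ENNReal.ofReal p) (volume.restrict Ω)) atTop (𝓝 0) := by
      refine tendsto_eLpNorm_zero_of_dominated hq0 ENNReal.ofReal_ne_top (b := (2 * L) • g)
        (fun n => ((hdφ n).sub hdf).smul hf.memLp_grad.1) (hf.memLp_grad.const_smul _)
        (fun n => .of_forall fun x => ?_) ?_
      · rw [norm_smul, Pi.smul_apply, norm_smul]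
        refine mul_le_mul_of_nonneg_right ?_ (norm_nonneg _)
        rw [Real.norm_of_nonneg (by positivity : 0 ≤ 2 * L)]
        have := norm_sub_le (deriv h (φ n x)) (deriv h (f x))
        have h5 := hL (φ n x)
        have h6 := hL (f x)
        simp only [Real.norm_eq_abs] at this ⊢
        linarith
      · filter_upwards [hae] with x hx
        have h5 := ((hd.tendsto (f x)).comp hx).sub_const (deriv h (f x))
        simpa using h5.smul_const (g x)
    refine tendsto_of_tendsto_of_tendsto_of_le_of_le tendsto_const_nhds
      (add_zero (0 : ℝ≥0∞) ▸ h3.add h4) (fun _ => zero_le) fun n => ?_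
    have h5 : gradient (h ∘ φ n) - (fun x => deriv h (f x) • g x) =
        (fun x => deriv h (φ n x) • (gradient (φ n) x - g x)) +
          fun x => (deriv h (φ n x) - deriv h (f x)) • g x := by
      rw [hgrad]
      ext1 x
      simp only [Pi.sub_apply, Pi.add_apply, smul_sub, sub_smul]
      abel
    rw [h5]
    refine (eLpNorm_add_le ((hdφ n).smul ((hgφ n).sub hf.memLp_grad.1))
      (((hdφ n).sub hdf).smul hf.memLp_grad.1) hq).trans ?_
    refine add_le_add_left ?_ _
    refine eLpNorm_le_mul_eLpNorm_of_ae_le_mul (.of_forall fun x => ?_) _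
    rw [Pi.smul_apply', norm_smul]
    exact mul_le_mul_of_nonneg_right (hL _) (norm_nonneg _)

theorem HasW0Gradient.add (hΩ : IsOpen Ω) (hΩb : Bornology.IsBounded Ω) (hp : 1 < p)
    {f₁ f₂ : RN N → ℝ} {g₁ g₂ : RN N → RN N} (h₁ : HasW0Gradient Ω p f₁ g₁)
    (h₂ : HasW0Gradient Ω p f₂ g₂) : HasW0Gradient Ω p (f₁ + f₂) (g₁ + g₂) := by
  obtain ⟨φ, hφ, h1, h1'⟩ := h₁.exists_approx
  obtain ⟨ψ, hψ, h2, h2'⟩ := h₂.exists_approx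
  have hq : 1 ≤ ENNReal.ofReal p := ENNReal.one_le_ofReal.2 hp.le
  have htest : ∀ n, IsTestFunction Ω (φ n + ψ n) := fun n =>
    ⟨(hφ n).contDiff.add (hψ n).contDiff, (hφ n).hasCompactSupport.add (hψ n).hasCompactSupport,
      (tsupport_add _ _).trans (Set.union_subset (hφ n).tsupport_subset (hψ n).tsupport_subset)⟩
  refine HasW0Gradient.of_tendsto hΩb hp (fun n => (htest n).hasW0Gradient hΩ hΩb)
    (h₁.memLp.add h₂.memLp) (h₁.memLp_grad.add h₂.memLp_grad) ?_ ?_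
  · refine tendsto_of_tendsto_of_tendsto_of_le_of_le tendsto_const_nhds
      (add_zero (0 : ℝ≥0∞) ▸ h1.add h2) (fun _ => zero_le) fun n => ?_
    rw [add_sub_add_comm]
    exact eLpNorm_add_le ((hφ n).contDiff.continuous.aestronglyMeasurable.sub h₁.memLp.1)
      ((hψ n).contDiff.continuous.aestronglyMeasurable.sub h₂.memLp.1) hq
  · refine tendsto_of_tendsto_of_tendsto_of_le_of_le tendsto_const_nhds
      (add_zero (0 : ℝ≥0∞) ▸ h1'.add h2') (fun _ => zero_le) fun n => ?_
    have h3 : gradient (φ n + ψ n) = gradient (φ n) + gradient (ψ n) := by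
      ext1 x
      simp only [gradient, Pi.add_apply]
      rw [fderiv_add (((hφ n).contDiff_one.differentiable one_ne_zero) x)
        (((hψ n).contDiff_one.differentiable one_ne_zero) x), map_add]
    rw [h3, add_sub_add_comm]
    exact eLpNorm_add_le ((continuous_gradient_of_contDiff
        (hφ n).contDiff_one).aestronglyMeasurable.sub h₁.memLp_grad.1)
      ((continuous_gradient_of_contDiff
        (hψ n).contDiff_one).aestronglyMeasurable.sub h₂.memLp_grad.1) hq

/-- Weak gradients are unique. -/
theorem HasWeakGradient.ae_eq (hΩ : IsOpen Ω) {f : RN N → ℝ} {g₁ g₂ : RN N → RN N}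
    (h₁ : HasWeakGradient Ω f g₁) (h₂ : HasWeakGradient Ω f g₂) :
    g₁ =ᵐ[volume.restrict Ω] g₂ := by
  -- Fundamental lemma of the calculus of variations for the vector field `g₁ - g₂`; the vector
  -- integrals are compared through their inner products with every direction `e`.
  have key : ∀ᵐ x ∂(volume : Measure (RN N)), x ∈ Ω → (g₁ - g₂) x = 0 := by
    have hloc := h₁.locallyIntegrable_grad.sub h₂.locallyIntegrable_grad
    refine hΩ.ae_eq_zero_of_integral_contDiff_smul_eq_zero hloc fun φ hφ hφc hφΩ => ?_
    have hφt : IsTestFunction Ω φ := ⟨hφ, hφc, hφΩ⟩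
    have hint : ∀ g : RN N → RN N, LocallyIntegrableOn g Ω volume →
        Integrable (fun x => φ x • g x) volume := by
      intro g hg
      have h3 : IntegrableOn (fun x => φ x • g x) (tsupport φ) volume :=
        (hg.integrableOn_compact_subset hφΩ hφc.isCompact).continuousOn_smul
          hφ.continuous.continuousOn hφc.isCompact
      rw [integrableOn_iff_integrable_of_support_subset] at h3
      · exact h3
      · intro x hx
        refine subset_tsupport _ fun h4 => hx ?_
        simp [h4]
    have hint₁ := hint g₁ h₁.locallyIntegrable_grad
    have hint₂ := hint g₂ h₂.locallyIntegrable_grad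
    have hI : ∀ g : RN N → RN N, Integrable (fun x => φ x • g x) volume → ∀ e,
        ∫ x in Ω, inner ℝ (g x) e * φ x = inner ℝ (∫ x, φ x • g x) e := by
      intro g hg e
      rw [setIntegral_eq_integral_of_forall_compl_eq_zero]
      · rw [real_inner_comm, ← integral_inner hg]
        refine integral_congr_ae (.of_forall fun x => ?_)
        simp only [inner_smul_right, real_inner_comm]
        ring
      · intro x hx
        rw [image_eq_zero_of_notMem_tsupport (fun h => hx (hφΩ h)), mul_zero]
    simp only [Pi.sub_apply, smul_sub]
    rw [integral_sub hint₁ hint₂, sub_eq_zero]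
    refine ext_inner_right ℝ fun e => ?_
    rw [← hI g₁ hint₁ e, ← hI g₂ hint₂ e]
    have h5 := h₁.integral_eq φ hφt e
    rw [h₂.integral_eq φ hφt e] at h5
    linarith
  refine (ae_restrict_iff' hΩ.measurableSet).2 ?_
  filter_upwards [key] with x hx hxΩ
  exact sub_eq_zero.1 (hx hxΩ)

/-- The Gagliardo-Nirenberg-Sobolev inequality in `W^{1,p}_0(Ω)`. -/
theorem exists_sobolev_const (hp : 1 < p) (hpN : p < N) :
    ∃ C : ℝ≥0∞, C ≠ ⊤ ∧ ∀ (f : RN N → ℝ) (g : RN N → RN N), HasW0Gradient Ω p f g →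
      eLpNorm f (ENNReal.ofReal (N * p / (N - p))) (volume.restrict Ω) ≤
        C * eLpNorm g (ENNReal.ofReal p) (volume.restrict Ω) := by
  have hN : (0 : ℝ) < N := by linarith
  have hq : 1 ≤ ENNReal.ofReal p := ENNReal.one_le_ofReal.2 hp.le
  refine ⟨SNormLESNormFDerivOfEqConst ℝ (volume : Measure (RN N)) (p.toNNReal : ℝ),
    ENNReal.coe_ne_top, fun f g hf => ?_⟩
  set C := (SNormLESNormFDerivOfEqConst ℝ (volume : Measure (RN N)) (p.toNNReal : ℝ) : ℝ≥0∞)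
  obtain ⟨φ, hφ, h1, h2, hae⟩ := hf.exists_approx_ae hp
  have hsob : ∀ n, eLpNorm (φ n) (ENNReal.ofReal (N * p / (N - p))) (volume.restrict Ω) ≤
      C * eLpNorm (gradient (φ n)) (ENNReal.ofReal p) (volume.restrict Ω) := by
    intro n
    have h3 := eLpNorm_le_eLpNorm_fderiv_of_eq (volume : Measure (RN N)) (hφ n).contDiff_one
      (hφ n).hasCompactSupport (p := p.toNNReal) (p' := (N * p / (N - p)).toNNReal)
      (by simpa using hp.le) (by simpa using hN)
      (by
        rw [NNReal.coe_inv, Real.coe_toNNReal p (by linarith),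
          Real.coe_toNNReal _ (div_nonneg (by nlinarith) (by linarith))]
        have : (N : ℝ) - p ≠ 0 := by linarith
        simp only [finrank_euclideanSpace, Fintype.card_fin]
        field_simp)
    refine (eLpNorm_mono_measure _ Measure.restrict_le_self).trans (h3.trans ?_)
    refine mul_le_mul_right ?_ _
    -- The inequality for test functions lives on all of `ℝ^N`; their gradients vanish outside `Ω`,
    -- so nothing is lost on restriction.
    have h4 : eLpNorm (gradient (φ n)) (ENNReal.ofReal p) (volume.restrict Ω) =
        eLpNorm (gradient (φ n)) (ENNReal.ofReal p) volume := by
      refine eLpNorm_restrict_eq_of_support_subset fun x hx => (hφ n).tsupport_subset ?_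
      by_contra h5
      refine hx ?_
      rw [gradient, fderiv_of_notMem_tsupport (𝕜 := ℝ) h5, map_zero]
    rw [h4]
    exact (eLpNorm_congr_norm_ae (.of_forall fun x => (norm_gradient_eq x).symm)).le
  have hlim : Tendsto (fun n => C * (eLpNorm (gradient (φ n) - g) (ENNReal.ofReal p)
      (volume.restrict Ω) + eLpNorm g (ENNReal.ofReal p) (volume.restrict Ω))) atTop
      (𝓝 (C * eLpNorm g (ENNReal.ofReal p) (volume.restrict Ω))) := by
    have h3 := h2.add_const (eLpNorm g (ENNReal.ofReal p) (volume.restrict Ω))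
    rw [zero_add] at h3
    exact ENNReal.Tendsto.const_mul h3 (Or.inr ENNReal.coe_ne_top)
  -- The approximating sequence is not known to converge in the Sobolev norm on the left, but it
  -- converges a.e., so lower semicontinuity (Fatou) suffices.
  refine (Lp.eLpNorm_lim_le_liminf_eLpNorm
    (fun n => (hφ n).contDiff.continuous.aestronglyMeasurable) f hae).trans ?_
  rw [← hlim.liminf_eq]
  refine liminf_le_liminf (.of_forall fun n => (hsob n).trans ?_)
  refine mul_le_mul_right ?_ _
  have h3 := eLpNorm_add_le (((continuous_gradient_of_contDiff
    (hφ n).contDiff_one).aestronglyMeasurable (μ := volume.restrict Ω)).sub hf.memLp_grad.1)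
    hf.memLp_grad.1 hq
  simpa using h3

end SobolevCalculus

/-! ### Capacity of the set where the quasi continuous representative is infinite. -/

section Capacity

variable {N : ℕ} {Ω : Set (RN N)} {p : ℝ}

theorem ofReal_norm_rpow {E : Type*} [NormedAddCommGroup E] (hp : 0 ≤ p) (y : E) :
    ENNReal.ofReal (‖y‖ ^ p) = ‖y‖ₑ ^ p := by
  rw [← ENNReal.ofReal_rpow_of_nonneg (norm_nonneg _) hp, ofReal_norm]

theorem pCapacity_mono {A B : Set (RN N)} (h : A ⊆ B) : pCapacity Ω p A ≤ pCapacity Ω p B := by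
  refine sInf_le_sInf ?_
  rintro c ⟨w, g, U, h1, h2, h3, h4⟩
  exact ⟨w, g, U, h1, h2, h.trans h3, h4⟩

theorem pCapacity_empty (hΩ : IsOpen Ω) (hΩb : Bornology.IsBounded Ω) (hp : 1 < p) :
    pCapacity Ω p ∅ = 0 := by
  refine le_antisymm (sInf_le ⟨(0 : RN N → ℝ), gradient (0 : RN N → ℝ), ∅, ?_,
    isOpen_empty, subset_rfl, ?_, ?_⟩) zero_le
  · exact hasW0Gradient_of_contDiff hΩ hΩb contDiff_const HasCompactSupport.zero (by simp [tsupport])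
  · simp
  · have h : ∀ x : RN N, gradient (0 : RN N → ℝ) x = 0 := fun x => by simp [gradient]
    simp [h, Real.zero_rpow (by linarith : p ≠ 0)]

theorem ContinuousOn.isQuasiContinuous (hΩ : IsOpen Ω) (hΩb : Bornology.IsBounded Ω) (hp : 1 < p)
    {Y : Type*} [TopologicalSpace Y] {f : RN N → Y} (hf : ContinuousOn f Ω) :
    IsQuasiContinuous Ω p f := fun ε hε =>
  ⟨∅, isOpen_empty, Set.empty_subset _, by rwa [pCapacity_empty hΩ hΩb hp], by simpa using hf⟩

/-- `Real.smoothTransition` plays the role of the truncation `s ↦ min(1, max(s,0))`. It is smooth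
with bounded derivative, so the chain rule for smooth functions applies to it. -/
theorem exists_abs_deriv_smoothTransition_le : ∃ L : ℝ, ∀ s, |deriv Real.smoothTransition s| ≤ L := by
  have hc : Continuous (deriv Real.smoothTransition) :=
    (Real.smoothTransition.contDiff (n := 1)).continuous_deriv le_rfl
  have hs : HasCompactSupport (deriv Real.smoothTransition) := by
    refine HasCompactSupport.intro (isCompact_Icc (a := (0 : ℝ)) (b := 1)) fun s hs => ?_
    rcases lt_or_ge s 0 with h | h
    · have h1 : Real.smoothTransition =ᶠ[𝓝 s] fun _ => 0 := by
        filter_upwards [Iio_mem_nhds h] with t ht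
        exact Real.smoothTransition.zero_of_nonpos (le_of_lt ht)
      rw [h1.deriv_eq, deriv_const]
    · have h2 : 1 < s := by
        by_contra h3
        exact hs ⟨h, not_lt.1 h3⟩
      have h1 : Real.smoothTransition =ᶠ[𝓝 s] fun _ => 1 := by
        filter_upwards [Ioi_mem_nhds h2] with t ht
        exact Real.smoothTransition.one_of_one_le (le_of_lt ht)
      rw [h1.deriv_eq, deriv_const]
  exact hc.bounded_above_of_compact_support hs

theorem trunc_nonneg (k : ℝ) (s : ℝ≥0∞) : 0 ≤ trunc k s := ENNReal.toReal_nonneg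

theorem trunc_eq_of_le {k : ℝ} (hk : 0 ≤ k) {s : ℝ≥0∞} (h : ENNReal.ofReal k ≤ s) :
    trunc k s = k := by
  rw [trunc, min_eq_right h, ENNReal.toReal_ofReal hk]

/-- Meant for `f₁ = T_k(u)` and `f₂` a competitor for the exceptional set `G` of quasi continuity.
As `f₂` may be negative away from `G`, it is replaced by its smooth transition, which is nonnegative
everywhere and equals `1` where `f₂ ≥ 1`; thus the sum is at least `1` both on `G` and where `u ≥
k`. The factor `2^{p-1}` comes from convexity of `s ↦ s^p`. -/
theorem HasW0Gradient.exists_competitor (hΩ : IsOpen Ω) (hΩb : Bornology.IsBounded Ω)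
    (hp : 1 < p) {L : ℝ} (hL : ∀ s, |deriv Real.smoothTransition s| ≤ L)
    {f₁ f₂ : RN N → ℝ} {g₁ g₂ : RN N → RN N} (h₁ : HasW0Gradient Ω p f₁ g₁)
    (h₂ : HasW0Gradient Ω p f₂ g₂) {k : ℝ} (hk : 0 < k) :
    ∃ g : RN N → RN N, HasW0Gradient Ω p (fun x => f₁ x / k + Real.smoothTransition (f₂ x)) g ∧
      ∫⁻ x in Ω, ENNReal.ofReal (‖g x‖ ^ p) ≤ 2 ^ (p - 1) *
        (ENNReal.ofReal (1 / k) ^ p * (∫⁻ x in Ω, ‖g₁ x‖ₑ ^ p) +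
          ENNReal.ofReal L ^ p * ∫⁻ x in Ω, ‖g₂ x‖ₑ ^ p) := by
  have hp0 : 0 ≤ p := by linarith
  have hd : ∀ s : ℝ, deriv (fun s : ℝ => s / k) s = 1 / k := fun s => by simp [deriv_div_const]
  have a₁ := h₁.comp_smooth hΩ hΩb hp (h := fun s => s / k) (by fun_prop) (by simp)
    (L := 1 / k) (fun s => by rw [hd, abs_of_pos (by positivity)])
  have a₂ := h₂.comp_smooth hΩ hΩb hp Real.smoothTransition.contDiff Real.smoothTransition.zero hL
  refine ⟨_, a₁.add hΩ hΩb hp a₂, ?_⟩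
  have hm₁ : AEMeasurable (fun x => ‖g₁ x‖ₑ ^ p) (volume.restrict Ω) :=
    h₁.memLp_grad.1.enorm.pow_const _
  have hm₂ : AEMeasurable (fun x => ‖g₂ x‖ₑ ^ p) (volume.restrict Ω) :=
    h₂.memLp_grad.1.enorm.pow_const _
  rw [← lintegral_const_mul'' _ hm₁, ← lintegral_const_mul'' _ hm₂,
    ← lintegral_add_left' (hm₁.const_mul _), ← lintegral_const_mul'']
  swap
  · exact (hm₁.const_mul _).add (hm₂.const_mul _)
  refine lintegral_mono fun x => ?_
  simp only [Pi.add_apply]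
  rw [ofReal_norm_rpow hp0]
  refine (ENNReal.rpow_le_rpow (enorm_add_le _ _) hp0).trans ?_
  refine (ENNReal.rpow_add_le_mul_rpow_add_rpow _ _ hp.le).trans ?_
  rw [enorm_smul, enorm_smul, ENNReal.mul_rpow_of_nonneg _ _ hp0, ENNReal.mul_rpow_of_nonneg _ _ hp0]
  have b₁ : ‖deriv (fun s : ℝ => s / k) (f₁ x)‖ₑ ≤ ENNReal.ofReal (1 / k) := by
    rw [hd, Real.enorm_eq_ofReal (by positivity)]
  have b₂ : ‖deriv Real.smoothTransition (f₂ x)‖ₑ ≤ ENNReal.ofReal L := by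
    rw [Real.enorm_eq_ofReal_abs]
    exact ENNReal.ofReal_le_ofReal (hL _)
  gcongr

/-- If the energy of the truncations `T_k(u)` grows at most linearly, then the quasi continuous
representative of `u` is finite outside of a Borel set of zero capacity. -/
theorem exists_measurableSet_pCapacity_eq_zero (hΩ : IsOpen Ω) (hΩb : Bornology.IsBounded Ω)
    (hp : 1 < p) {u w : RN N → ℝ≥0∞} {v : RN N → RN N} (hw : IsQuasiContinuousRep Ω p u w)
    (hT : ∀ k : ℝ, 0 < k → HasW0Gradient Ω p (fun x => trunc k (u x))
      ({x | u x ≤ ENNReal.ofReal k}.indicator v))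
    {C : ℝ≥0∞} (hC : C ≠ ⊤) (hE : ∀ k : ℝ, 1 ≤ k →
      ∫⁻ x in Ω, ‖({x | u x ≤ ENNReal.ofReal k}.indicator v) x‖ₑ ^ p ≤ C * ENNReal.ofReal k) :
    ∃ B : Set (RN N), MeasurableSet B ∧ B ⊆ Ω ∧ pCapacity Ω p B = 0 ∧
      ∀ x ∈ Ω, w x = ∞ → x ∈ B := by
  have hp0 : 0 ≤ p := by linarith
  obtain ⟨L, hL⟩ := exists_abs_deriv_smoothTransition_le
  have step : ∀ n : ℕ, ∃ U : Set (RN N), IsOpen U ∧ U ⊆ Ω ∧ (∀ x ∈ Ω, w x = ∞ → x ∈ U) ∧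
      pCapacity Ω p U ≤ 2 ^ (p - 1) * (C * ENNReal.ofReal (((n : ℝ) + 1) ^ (1 - p)) +
        ENNReal.ofReal L ^ p * ENNReal.ofReal (1 / ((n : ℝ) + 1))) := by
    intro n
    set k : ℝ := (n : ℝ) + 1 with hk
    have hk1 : 1 ≤ k := by simp [hk]
    have hk0 : 0 < k := by linarith
    obtain ⟨G, hG, hGΩ, hGc, hGw⟩ := hw.quasiContinuous (ENNReal.ofReal (1 / k))
      (by rw [ENNReal.ofReal_pos]; positivity)
    obtain ⟨c, ⟨wG, gG, UG, h1, h2, h3, h4, rfl⟩, hc⟩ := sInf_lt_iff.1 hGc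
    -- `{w > k}` is only relatively open in `Ω \ G`, where it is cut out by an open set `V`. Adding
    -- `G` gives an open set `(V ∩ Ω) ∪ G` that contains all points of `Ω` with `w = ∞`.
    obtain ⟨V, hV, hVw⟩ := continuousOn_iff'.1 hGw (Set.Ioi (ENNReal.ofReal k)) isOpen_Ioi
    refine ⟨(V ∩ Ω) ∪ G, (hV.inter hΩ).union hG, Set.union_subset Set.inter_subset_right hGΩ,
      ?_, ?_⟩
    · intro x hx hxw
      by_cases hxG : x ∈ G
      · exact Or.inr hxG
      · have : x ∈ w ⁻¹' (Set.Ioi (ENNReal.ofReal k)) ∩ (Ω \ G) := ⟨by simp [hxw], hx, hxG⟩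
        rw [hVw] at this
        exact Or.inl ⟨this.1, hx⟩
    · obtain ⟨g, hg, hgle⟩ := (hT k hk0).exists_competitor hΩ hΩb hp hL h1 hk0
      refine le_trans (sInf_le ⟨_, g, (V ∩ Ω) ∪ G, hg, (hV.inter hΩ).union hG, subset_rfl, ?_, rfl⟩)
        (hgle.trans ?_)
      · rw [ae_restrict_iff' (((hV.inter hΩ).union hG).inter hΩ).measurableSet]
        rw [ae_restrict_iff' (h2.inter hΩ).measurableSet] at h4
        filter_upwards [h4, (ae_restrict_iff' hΩ.measurableSet).1 hw.ae_eq] with x hx1 hx2 hx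
        by_cases hxG : x ∈ G
        · rw [Real.smoothTransition.one_of_one_le (hx1 ⟨h3 hxG, hx.2⟩)]
          have := div_nonneg (trunc_nonneg k (u x)) hk0.le
          linarith
        · have hxV : x ∈ V ∩ (Ω \ G) := ⟨(hx.1.resolve_right hxG).1, hx.2, hxG⟩
          rw [← hVw] at hxV
          have h5 : ENNReal.ofReal k < u x := by rw [hx2 hx.2]; exact hxV.1
          rw [trunc_eq_of_le hk0.le h5.le, div_self hk0.ne']
          have := Real.smoothTransition.nonneg (wG x)
          linarith
      · have e1 : ENNReal.ofReal (1 / k) ^ p * (C * ENNReal.ofReal k) =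
            C * ENNReal.ofReal (k ^ (1 - p)) := by
          rw [ENNReal.ofReal_rpow_of_pos (by positivity), mul_left_comm,
            ← ENNReal.ofReal_mul (by positivity), Real.div_rpow zero_le_one hk0.le, Real.one_rpow,
            Real.rpow_sub hk0, Real.rpow_one, one_div_mul_eq_div]
        rw [← e1]
        have e2 := hE k hk1
        have e3 : ∫⁻ x in Ω, ‖gG x‖ₑ ^ p ≤ ENNReal.ofReal (1 / k) := by
          simpa only [ofReal_norm_rpow hp0] using hc.le
        gcongr
  choose U hU hUΩ hUw hUc using step
  -- `w` is not assumed Borel, so `{w = ∞}` is enclosed in a countable intersection of open sets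
  -- whose capacities tend to zero.
  refine ⟨⋂ n, U n, MeasurableSet.iInter fun n => (hU n).measurableSet,
    (Set.iInter_subset _ 0).trans (hUΩ 0), ?_, fun x hx hxw => Set.mem_iInter.2 fun n =>
      hUw n x hx hxw⟩
  have hlim : Tendsto (fun n : ℕ => (2 : ℝ≥0∞) ^ (p - 1) *
      (C * ENNReal.ofReal (((n : ℝ) + 1) ^ (1 - p)) +
        ENNReal.ofReal L ^ p * ENNReal.ofReal (1 / ((n : ℝ) + 1)))) atTop (𝓝 0) := by
    have t0 : Tendsto (fun n : ℕ => ((n : ℝ) + 1)) atTop atTop :=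
      tendsto_atTop_add_const_right _ _ tendsto_natCast_atTop_atTop
    have t1 := ENNReal.tendsto_ofReal
      ((tendsto_rpow_neg_atTop (by linarith : 0 < p - 1)).comp t0)
    have t2 := ENNReal.tendsto_ofReal (tendsto_one_div_add_atTop_nhds_zero_nat (𝕜 := ℝ))
    have t3 := (ENNReal.Tendsto.const_mul t1 (Or.inr hC)).add (ENNReal.Tendsto.const_mul t2
      (Or.inr (ENNReal.rpow_ne_top_of_nonneg hp0 (ENNReal.ofReal_ne_top (r := L)))))
    have t4 := ENNReal.Tendsto.const_mul t3 (Or.inr (ENNReal.rpow_ne_top_of_nonneg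
      (by linarith : 0 ≤ p - 1) ENNReal.ofNat_ne_top : (2 : ℝ≥0∞) ^ (p - 1) ≠ ⊤))
    simpa [Function.comp_def] using t4
  refine le_antisymm (ge_of_tendsto' hlim fun n => ?_) zero_le
  exact (pCapacity_mono (Set.iInter_subset _ n)).trans (hUc n)

end Capacity

/-! ### Linear growth of the energy of the truncations. -/

section Energy

variable {N : ℕ} {Ω : Set (RN N)} {p : ℝ}

/-- Composition with a Carathéodory function preserves measurability. -/
theorem IsLerayLions.aestronglyMeasurable_comp {a : RN N → RN N → RN N} (ha : IsLerayLions Ω p a)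
    {v : RN N → RN N} (hv : AEStronglyMeasurable v (volume.restrict Ω)) :
    AEStronglyMeasurable (fun x => a x (v x)) (volume.restrict Ω) := by
  refine AEMeasurable.aestronglyMeasurable ?_
  -- For a simple field, `a(x, s(x))` is a finite sum of measurable pieces; continuity of `a(x,·)`
  -- then passes to the limit of simple approximations of `v`.
  have hsimple : ∀ s : SimpleFunc (RN N) (RN N),
      AEMeasurable (fun x => a x (s x)) (volume.restrict Ω) := by
    intro s
    have h1 : (fun x => a x (s x)) =
        fun x => ∑ y ∈ s.range, (s ⁻¹' {y}).indicator (fun x => a x y) x := by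
      ext1 x
      rw [Finset.sum_eq_single (s x)]
      · simp
      · intro y _ hy
        exact Set.indicator_of_notMem (fun h => hy h.symm) _
      · intro h
        exact absurd (s.mem_range_self x) h
    rw [h1]
    exact Finset.aemeasurable_fun_sum _ fun y _ =>
      (ha.aemeasurable y).indicator (s.measurableSet_preimage _)
  refine aemeasurable_of_tendsto_metrizable_ae atTop
    (fun n => hsimple (hv.stronglyMeasurable_mk.approx n)) ?_
  filter_upwards [ha.continuous, hv.ae_eq_mk] with x hx hxv
  rw [hxv]
  exact (hx.tendsto _).comp (hv.stronglyMeasurable_mk.tendsto_approx x)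

/-- By uniqueness of weak gradients the same approximating sequence serves `g'`. This turns the
unspecified gradient in `MemW0` for `T_k(u)` into `v χ_{u ≤ k}`. -/
theorem HasW0Gradient.congr_grad (hΩ : IsOpen Ω) {f : RN N → ℝ} {g g' : RN N → RN N}
    (hf : HasW0Gradient Ω p f g) (hg' : HasWeakGradient Ω f g') : HasW0Gradient Ω p f g' := by
  have h := hf.hasWeakGradient.ae_eq hΩ hg'
  refine ⟨hf.memLp, hf.memLp_grad.ae_eq h, hg', ?_⟩
  obtain ⟨φ, h1, h2, h3⟩ := hf.exists_approx
  refine ⟨φ, h1, h2, h3.congr fun n => eLpNorm_congr_ae ?_⟩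
  filter_upwards [h] with x hx
  rw [hx]

variable {u : RN N → ℝ≥0∞} {v : RN N → RN N}

theorem nullMeasurableSet_le_ofReal (hu : AEMeasurable u (volume.restrict Ω)) (k : ℝ) :
    NullMeasurableSet {x | u x ≤ ENNReal.ofReal k} (volume.restrict Ω) :=
  nullMeasurableSet_le hu aemeasurable_const

theorem nullMeasurableSet_band (hu : AEMeasurable u (volume.restrict Ω)) (t : ℝ) :
    NullMeasurableSet {x | ENNReal.ofReal t < u x ∧ u x < ENNReal.ofReal (2 * t)}
      (volume.restrict Ω) :=
  (nullMeasurableSet_lt aemeasurable_const hu).inter (nullMeasurableSet_lt hu aemeasurable_const)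

/-- `u` is only a.e. measurable on `Ω`, so the band is null measurable for the restricted measure;
the restriction is therefore performed in two stages. -/
theorem restrict_band_eq (hu : AEMeasurable u (volume.restrict Ω)) (t : ℝ) :
    volume.restrict {x | x ∈ Ω ∧ ENNReal.ofReal t < u x ∧ u x < ENNReal.ofReal (2 * t)} =
      (volume.restrict Ω).restrict
        {x | ENNReal.ofReal t < u x ∧ u x < ENNReal.ofReal (2 * t)} := by
  rw [Measure.restrict_restrict₀ (nullMeasurableSet_band hu t), Set.inter_comm]
  rfl

theorem lintegral_indicator_rpow (hp : 0 < p) (hu : AEMeasurable u (volume.restrict Ω)) (k : ℝ) :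
    ∫⁻ x in Ω, ‖({x | u x ≤ ENNReal.ofReal k}.indicator v) x‖ₑ ^ p =
      ∫⁻ x in {x | u x ≤ ENNReal.ofReal k}, ‖v x‖ₑ ^ p ∂(volume.restrict Ω) := by
  rw [← lintegral_indicator₀ (nullMeasurableSet_le_ofReal hu k)]
  refine lintegral_congr fun x => ?_
  by_cases hx : x ∈ {x | u x ≤ ENNReal.ofReal k}
  · simp only [Set.indicator_of_mem hx]
  · simp only [Set.indicator_of_notMem hx]
    simp [hp]

theorem lintegral_energy_lt_top (hp : 1 < p) (hu : AEMeasurable u (volume.restrict Ω))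
    {k : ℝ} (hT : HasW0Gradient Ω p (fun x => trunc k (u x))
      ({x | u x ≤ ENNReal.ofReal k}.indicator v)) :
    ∫⁻ x in {x | u x ≤ ENNReal.ofReal k}, ‖v x‖ₑ ^ p ∂(volume.restrict Ω) < ⊤ := by
  rw [← lintegral_indicator_rpow (by linarith) hu]
  have h := lintegral_rpow_enorm_lt_top_of_eLpNorm_lt_top (by simp; linarith)
    ENNReal.ofReal_ne_top hT.memLp_grad.2
  rwa [ENNReal.toReal_ofReal (by linarith)] at h

/-- Where `u` is bounded, the flux `a(x,∇u)·∇u` is integrable. -/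
theorem IsLerayLions.integrable_flux {a : RN N → RN N → RN N} (ha : IsLerayLions Ω p a)
    (hp : 1 < p) (hu : AEMeasurable u (volume.restrict Ω))
    (hv : AEStronglyMeasurable v (volume.restrict Ω)) {k : ℝ}
    (hT : HasW0Gradient Ω p (fun x => trunc k (u x)) ({x | u x ≤ ENNReal.ofReal k}.indicator v)) :
    IntegrableOn (fun x => inner ℝ (a x (v x)) (v x)) {x | u x ≤ ENNReal.ofReal k}
      (volume.restrict Ω) := by
  obtain ⟨β, hβ, hgr⟩ := ha.growth
  have hp0 : 0 ≤ p := by linarith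
  refine ⟨((ha.aestronglyMeasurable_comp hv).inner hv).restrict, ?_⟩
  refine lt_of_le_of_lt (b := ENNReal.ofReal β *
    ∫⁻ x in {x | u x ≤ ENNReal.ofReal k}, ‖v x‖ₑ ^ p ∂(volume.restrict Ω)) ?_
    (ENNReal.mul_lt_top ENNReal.ofReal_lt_top (lintegral_energy_lt_top hp hu hT))
  rw [← lintegral_const_mul'' _ (hv.enorm.pow_const p).restrict]
  refine lintegral_mono_ae (ae_restrict_of_ae ?_)
  filter_upwards [hgr] with x hx
  rw [← ofReal_norm_rpow hp0, ← ENNReal.ofReal_mul hβ.le, Real.enorm_eq_ofReal_abs]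
  refine ENNReal.ofReal_le_ofReal ((abs_real_inner_le_norm _ _).trans ?_)
  calc _ ≤ β * ‖v x‖ ^ (p - 1) * ‖v x‖ := by gcongr; exact hx _
    _ = _ := by
      rcases eq_or_ne (v x) 0 with h | h
      · simp [h, Real.zero_rpow (by linarith : p ≠ 0)]
      · rw [mul_assoc, ← Real.rpow_add_one (norm_ne_zero_iff.2 h), sub_add_cancel]

/-- The energy of the truncations of `u` grows at most linearly if the mean of the flux over
`{t < u < 2t}` remains bounded. -/
theorem exists_energy_bound {a : RN N → RN N → RN N} (ha : IsLerayLions Ω p a)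
    (hp : 1 < p) (hu : AEMeasurable u (volume.restrict Ω))
    (hv : AEStronglyMeasurable v (volume.restrict Ω))
    (hT : ∀ k : ℝ, 0 < k → HasW0Gradient Ω p (fun x => trunc k (u x))
      ({x | u x ≤ ENNReal.ofReal k}.indicator v))
    {ℓ : ℝ} (hlim : Tendsto (fun t : ℝ => (1 / t) *
      ∫ x in {x | x ∈ Ω ∧ ENNReal.ofReal t < u x ∧ u x < ENNReal.ofReal (2 * t)},
        inner ℝ (a x (v x)) (v x)) atTop (𝓝 ℓ)) :
    ∃ C : ℝ≥0∞, C ≠ ⊤ ∧ ∀ k : ℝ, 1 ≤ k →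
      ∫⁻ x in {x | u x ≤ ENNReal.ofReal k}, ‖v x‖ₑ ^ p ∂(volume.restrict Ω) ≤
        C * ENNReal.ofReal k := by
  have hp0 : 0 ≤ p := by linarith
  obtain ⟨α, hα, hco⟩ := ha.coercive
  obtain ⟨t₀, ht₀⟩ := eventually_atTop.1 (hlim.eventually (gt_mem_nhds (lt_add_one ℓ)))
  set F : ℝ → ℝ≥0∞ := fun k =>
    ∫⁻ x in {x | u x ≤ ENNReal.ofReal k}, ‖v x‖ₑ ^ p ∂(volume.restrict Ω) with hF
  have hFmono : Monotone F := fun s t hst => lintegral_mono_set fun x hx =>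
    le_trans hx (ENNReal.ofReal_le_ofReal hst)
  have hFtop : ∀ k, 0 < k → F k ≠ ⊤ := fun k hk => (lintegral_energy_lt_top hp hu (hT k hk)).ne
  set C₁ : ℝ≥0∞ := ENNReal.ofReal ((ℓ + 1) / α) with hC₁
  set s : ℝ := max t₀ 1 with hs
  have hs1 : 1 ≤ s := le_max_right _ _
  -- The factor `3/2` instead of `2`: the band `{t < u < 2t}` is open above and does not cover `{u =
  -- 2t}`, while it does cover `{t < u ≤ 3t/2}`.
  have hband : ∀ t, s ≤ t → F (3 / 2 * t) ≤ F t + C₁ * ENNReal.ofReal t := by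
    intro t hst
    have ht1 : 1 ≤ t := hs1.trans hst
    have ht : 0 < t := by linarith
    set D := {x | ENNReal.ofReal t < u x ∧ u x < ENNReal.ofReal (2 * t)} with hD
    have h1 : F (3 / 2 * t) ≤ F t + ∫⁻ x in D, ‖v x‖ₑ ^ p ∂(volume.restrict Ω) := by
      refine (lintegral_mono_set fun x hx => ?_).trans (lintegral_union_le _ _ _)
      rcases le_or_gt (u x) (ENNReal.ofReal t) with h | h
      · exact Or.inl h
      · refine Or.inr ⟨h, lt_of_le_of_lt hx ?_⟩
        rw [ENNReal.ofReal_lt_ofReal_iff (by linarith)]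
        linarith
    refine h1.trans (add_le_add_right ?_ _)
    have hint : IntegrableOn (fun x => inner ℝ (a x (v x)) (v x)) D (volume.restrict Ω) :=
      (ha.integrable_flux hp hu hv (hT (2 * t) (by linarith))).mono_set fun x hx => hx.2.le
    have h2 := ht₀ t ((le_max_left _ _).trans hst)
    rw [restrict_band_eq hu] at h2
    have h3 : ∫ x in D, inner ℝ (a x (v x)) (v x) ∂(volume.restrict Ω) ≤ (ℓ + 1) * t := by
      have := mul_le_mul_of_nonneg_right h2.le ht.le
      rw [mul_comm, ← mul_assoc, mul_one_div_cancel ht.ne', one_mul] at this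
      exact this
    have h4 : ENNReal.ofReal α * ∫⁻ x in D, ‖v x‖ₑ ^ p ∂(volume.restrict Ω) ≤
        ENNReal.ofReal ((ℓ + 1) * t) := by
      refine le_trans ?_ (ENNReal.ofReal_le_ofReal h3)
      rw [ofReal_integral_eq_lintegral_ofReal hint, ← lintegral_const_mul''
        _ (hv.enorm.pow_const p).restrict]
      · refine lintegral_mono_ae (ae_restrict_of_ae ?_)
        filter_upwards [hco] with x hx
        rw [← ofReal_norm_rpow hp0, ← ENNReal.ofReal_mul hα.le]
        exact ENNReal.ofReal_le_ofReal (hx _)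
      · refine ae_restrict_of_ae ?_
        filter_upwards [hco] with x hx
        exact le_trans (by positivity) (hx _)
    rw [hC₁, ← ENNReal.ofReal_mul' ht.le, div_mul_eq_mul_div, ENNReal.ofReal_div_of_pos hα,
      ENNReal.le_div_iff_mul_le (by simp [hα]) (by simp), mul_comm]
    exact h4
  -- The induction step from `r` to `3r/2` needs `A r + C₁ r ≤ (3/2) A r`, that is `C₁ ≤ A/2`; the
  -- summand `F s` starts the induction.
  set A : ℝ≥0∞ := F s + 2 * C₁ with hA
  have hAtop : A ≠ ⊤ := ENNReal.add_ne_top.2 ⟨hFtop s (by linarith), by finiteness⟩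
  have hiter : ∀ n : ℕ, F (s * (3 / 2) ^ n) ≤ A * ENNReal.ofReal (s * (3 / 2) ^ n) := by
    intro n
    induction n with
    | zero =>
      rw [pow_zero, mul_one]
      calc F s ≤ A * 1 := by rw [mul_one]; exact le_self_add
        _ ≤ _ := by gcongr; simpa using hs1
    | succ n ih =>
      have h1 : s ≤ s * (3 / 2) ^ n := le_mul_of_one_le_right (by linarith)
        (one_le_pow₀ (by norm_num))
      have e : s * (3 / 2) ^ (n + 1) = 3 / 2 * (s * (3 / 2) ^ n) := by ring
      rw [e]
      refine (hband _ h1).trans ((add_le_add_left ih _).trans ?_)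
      have e2 : ENNReal.ofReal (3 / 2 * (s * (3 / 2) ^ n)) = ENNReal.ofReal (s * (3 / 2) ^ n) +
          ENNReal.ofReal (1 / 2) * ENNReal.ofReal (s * (3 / 2) ^ n) := by
        rw [← ENNReal.ofReal_mul (by norm_num), ← ENNReal.ofReal_add (by linarith) (by linarith)]
        ring_nf
      rw [e2, mul_add, ← mul_assoc]
      refine add_le_add_right (mul_le_mul_left ?_ _) _
      calc C₁ = 2 * C₁ * ENNReal.ofReal (1 / 2) := by
            rw [mul_comm 2 C₁, mul_assoc, ← ENNReal.ofReal_ofNat 2, ← ENNReal.ofReal_mul (by norm_num)]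
            norm_num
        _ ≤ _ := by gcongr; exact le_add_self
  refine ⟨A * ENNReal.ofReal (3 / 2), ENNReal.mul_ne_top hAtop ENNReal.ofReal_ne_top,
    fun k hk => ?_⟩
  rcases le_or_gt s k with h | h
  · obtain ⟨n, hn1, hn2⟩ := exists_nat_pow_near (x := k / s) (y := (3 / 2 : ℝ))
      ((one_le_div (by linarith)).2 h) (by norm_num)
    rw [le_div_iff₀ (by linarith)] at hn1
    rw [div_lt_iff₀ (by linarith)] at hn2
    calc F k ≤ F (s * (3 / 2) ^ (n + 1)) := hFmono (by linarith)
      _ ≤ A * ENNReal.ofReal (s * (3 / 2) ^ (n + 1)) := hiter _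
      _ ≤ A * ENNReal.ofReal (3 / 2 * k) := by
        refine mul_le_mul_right (ENNReal.ofReal_le_ofReal ?_) _
        rw [pow_succ]
        linarith
      _ = _ := by rw [ENNReal.ofReal_mul (by norm_num), mul_assoc]
  · calc F k ≤ F s := hFmono h.le
      _ ≤ A * 1 * 1 := by rw [mul_one, mul_one]; exact le_self_add
      _ ≤ _ := by
        gcongr
        · simp; norm_num
        · simpa using hk

end Energy

/-! ### Integrability of `|∇u|^{p-1}`. -/

section GradientIntegrability

variable {N : ℕ} {Ω : Set (RN N)} {p : ℝ} {u : RN N → ℝ≥0∞} {v : RN N → RN N}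

/-- Decay of the superlevel sets of `u`. -/
theorem exists_superlevel_bound (hp : 1 < p) (hpN : p < N)
    (hu : AEMeasurable u (volume.restrict Ω))
    (hT : ∀ k : ℝ, 0 < k → HasW0Gradient Ω p (fun x => trunc k (u x))
      ({x | u x ≤ ENNReal.ofReal k}.indicator v))
    {C : ℝ≥0∞} (hC : C ≠ ⊤) (hE : ∀ k : ℝ, 1 ≤ k →
      ∫⁻ x in {x | u x ≤ ENNReal.ofReal k}, ‖v x‖ₑ ^ p ∂(volume.restrict Ω) ≤
        C * ENNReal.ofReal k) :
    ∃ C' : ℝ≥0∞, C' ≠ ⊤ ∧ ∀ k : ℝ, 1 ≤ k →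
      volume.restrict Ω {x | ENNReal.ofReal k ≤ u x} ≤
        C' * ENNReal.ofReal (k ^ (-(N * (p - 1) / (N - p)))) := by
  have hp0 : 0 < p := by linarith
  have hNp : 0 < (N : ℝ) - p := by linarith
  have hN : (0 : ℝ) < N := by linarith
  obtain ⟨K, hK, hsob⟩ := exists_sobolev_const (N := N) (Ω := Ω) hp hpN
  set q : ℝ := N * p / (N - p) with hq
  have hq0 : 0 < q := by positivity
  have hqt : (ENNReal.ofReal q).toReal = q := ENNReal.toReal_ofReal hq0.le
  refine ⟨K ^ q * C ^ (q / p), ENNReal.mul_ne_top (ENNReal.rpow_ne_top_of_nonneg hq0.le hK)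
    (ENNReal.rpow_ne_top_of_nonneg (by positivity) hC), fun k hk => ?_⟩
  have hk0 : 0 < k := by linarith
  -- Chebyshev's inequality in the Sobolev exponent `q = Np/(N-p)` for `T_k(u)`, which equals `k` on
  -- `{u ≥ k}`. With the energy bound the resulting power of `k` is `q/p - q = -N(p-1)/(N-p)`.
  have h1 := mul_meas_ge_le_pow_eLpNorm' (volume.restrict Ω) (p := ENNReal.ofReal q)
    (by simpa using hq0) ENNReal.ofReal_ne_top (hT k hk0).memLp.1 (ENNReal.ofReal k)
  rw [hqt] at h1
  have h2 : {x | ENNReal.ofReal k ≤ u x} ⊆ {x | ENNReal.ofReal k ≤ ‖trunc k (u x)‖ₑ} := by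
    intro x hx
    simp only [Set.mem_ofPred_eq] at hx ⊢
    rw [trunc_eq_of_le hk0.le hx, Real.enorm_eq_ofReal hk0.le]
  have h3 : eLpNorm ({x | u x ≤ ENNReal.ofReal k}.indicator v) (ENNReal.ofReal p)
      (volume.restrict Ω) ≤ (C * ENNReal.ofReal k) ^ (1 / p) := by
    rw [eLpNorm_eq_lintegral_rpow_enorm_toReal (by simpa using hp0) ENNReal.ofReal_ne_top,
      ENNReal.toReal_ofReal hp0.le, lintegral_indicator_rpow hp0 hu]
    exact ENNReal.rpow_le_rpow (hE k hk) (by positivity)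
  have h4 : ENNReal.ofReal k ^ q * volume.restrict Ω {x | ENNReal.ofReal k ≤ u x} ≤
      (K * (C * ENNReal.ofReal k) ^ (1 / p)) ^ q := by
    refine le_trans (by gcongr) (h1.trans (ENNReal.rpow_le_rpow ?_ hq0.le))
    exact (hsob _ _ (hT k hk0)).trans (mul_le_mul_right h3 _)
  have hk' : ENNReal.ofReal k ^ q ≠ 0 := by
    rw [ENNReal.ofReal_rpow_of_pos hk0]
    simp only [ne_eq, ENNReal.ofReal_eq_zero, not_le]
    positivity
  rw [mul_comm, ← ENNReal.le_div_iff_mul_le (Or.inl hk')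
    (Or.inl (ENNReal.rpow_ne_top_of_nonneg hq0.le ENNReal.ofReal_ne_top))] at h4
  refine h4.trans (le_of_eq ?_)
  rw [ENNReal.mul_rpow_of_nonneg _ _ hq0.le, ← ENNReal.rpow_mul,
    ENNReal.mul_rpow_of_nonneg _ _ (by positivity), one_div_mul_eq_div, ← mul_assoc, mul_div_assoc,
    ENNReal.ofReal_rpow_of_pos hk0, ENNReal.ofReal_rpow_of_pos hk0,
    ← ENNReal.ofReal_div_of_pos (by positivity), ← Real.rpow_sub hk0]
  congr 4
  rw [hq]
  field_simp
  ring

/-- Hölder's inequality against the constant `1`, with exponents `p/(p-1)` and `p`. -/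
theorem lintegral_rpow_sub_one_le {α : Type*} [MeasurableSpace α] {μ : Measure α} (hp : 1 < p)
    {f : α → ℝ≥0∞} (hf : AEMeasurable f μ) :
    ∫⁻ x, f x ^ (p - 1) ∂μ ≤ (∫⁻ x, f x ^ p ∂μ) ^ ((p - 1) / p) * μ Set.univ ^ (1 / p) := by
  have hpq : (p / (p - 1)).HolderConjugate p := (Real.HolderConjugate.conjExponent hp).symm
  have h := ENNReal.lintegral_mul_le_Lp_mul_Lq μ hpq (hf.pow_const (p - 1))
    (aemeasurable_const (b := (1 : ℝ≥0∞)))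
  have hp1 : p - 1 ≠ 0 := by linarith
  have e : (p - 1) * (p / (p - 1)) = p := by field_simp
  simpa [← ENNReal.rpow_mul, e] using h

/-- `|∇u|^{p-1}` is integrable if the energy of the truncations of `u` grows at most linearly. -/
theorem lintegral_grad_rpow_lt_top (hΩb : Bornology.IsBounded Ω) (hp : 1 < p) (hpN : p < N)
    (hu : AEMeasurable u (volume.restrict Ω)) (hufin : ∀ᵐ x ∂(volume.restrict Ω), u x < ∞)
    (hv : AEStronglyMeasurable v (volume.restrict Ω))
    (hT : ∀ k : ℝ, 0 < k → HasW0Gradient Ω p (fun x => trunc k (u x))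
      ({x | u x ≤ ENNReal.ofReal k}.indicator v))
    {C : ℝ≥0∞} (hC : C ≠ ⊤) (hE : ∀ k : ℝ, 1 ≤ k →
      ∫⁻ x in {x | u x ≤ ENNReal.ofReal k}, ‖v x‖ₑ ^ p ∂(volume.restrict Ω) ≤
        C * ENNReal.ofReal k) :
    ∫⁻ x in Ω, ‖v x‖ₑ ^ (p - 1) < ⊤ := by
  have := isFiniteMeasure_restrict_of_isBounded hΩb
  have hp0 : 0 < p := by linarith
  have hp1 : 0 < p - 1 := by linarith
  have hNp : 0 < (N : ℝ) - p := by linarith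
  have hN : (0 : ℝ) < N := by linarith
  obtain ⟨C', hC', hsup⟩ := exists_superlevel_bound hp hpN hu hT hC hE
  -- The exponent left by Hölder on a dyadic band: `(p-1)/p · (1 - N/(N-p)) = -δ`. Its negativity
  -- makes the series over the bands converge.
  set δ : ℝ := (p - 1) / (N - p) with hδ
  have hδ0 : 0 < δ := by positivity
  let D : ℕ → Set (RN N) := fun j =>
    {x | ENNReal.ofReal (2 ^ j) < u x ∧ u x ≤ ENNReal.ofReal (2 ^ (j + 1))}
  set A : ℝ≥0∞ := (C * 2) ^ ((p - 1) / p) * C' ^ (1 / p) with hA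
  have hAtop : A ≠ ⊤ := by
    refine ENNReal.mul_ne_top (ENNReal.rpow_ne_top_of_nonneg (by positivity) ?_)
      (ENNReal.rpow_ne_top_of_nonneg (by positivity) hC')
    exact ENNReal.mul_ne_top hC ENNReal.ofNat_ne_top
  have hD : ∀ j : ℕ, ∫⁻ x in D j, ‖v x‖ₑ ^ (p - 1) ∂(volume.restrict Ω) ≤
      A * ENNReal.ofReal (2 ^ (-δ)) ^ j := by
    intro j
    set k : ℝ := 2 ^ j with hk
    have hk1 : 1 ≤ k := one_le_pow₀ (by norm_num)
    have hk0 : 0 < k := by linarith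
    refine (lintegral_rpow_sub_one_le hp hv.enorm.restrict).trans ?_
    have h1 : ∫⁻ x in D j, ‖v x‖ₑ ^ p ∂(volume.restrict Ω) ≤ C * ENNReal.ofReal (2 * k) := by
      refine (lintegral_mono_set fun x hx => ?_).trans (hE (2 * k) (by linarith))
      have h2 := hx.2
      rw [pow_succ, mul_comm] at h2
      exact h2
    have h2 : (volume.restrict Ω).restrict (D j) Set.univ ≤
        C' * ENNReal.ofReal (k ^ (-(N * (p - 1) / (N - p)))) := by
      rw [Measure.restrict_apply_univ]
      exact (measure_mono fun x hx => hx.1.le).trans (hsup k hk1)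
    calc _ ≤ (C * ENNReal.ofReal (2 * k)) ^ ((p - 1) / p) *
          (C' * ENNReal.ofReal (k ^ (-(N * (p - 1) / (N - p))))) ^ (1 / p) := by gcongr
      _ = A * ENNReal.ofReal (k ^ (-δ)) := by
        rw [ENNReal.ofReal_mul (by norm_num), ENNReal.ofReal_ofNat, ← mul_assoc,
          ENNReal.mul_rpow_of_nonneg _ _ (by positivity),
          ENNReal.mul_rpow_of_nonneg C' _ (by positivity), mul_mul_mul_comm, ← hA,
          ENNReal.ofReal_rpow_of_pos hk0, ENNReal.ofReal_rpow_of_pos (by positivity),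
          ← Real.rpow_mul hk0.le, ← ENNReal.ofReal_mul (by positivity), ← Real.rpow_add hk0]
        congr 3
        rw [hδ]
        field_simp
        ring
      _ = _ := by
        rw [← ENNReal.ofReal_pow (by positivity), hk, ← Real.rpow_natCast, ← Real.rpow_natCast,
          ← Real.rpow_mul (by norm_num), ← Real.rpow_mul (by norm_num), mul_comm (j : ℝ)]
  have hcover : ∀ᵐ x ∂(volume.restrict Ω),
      x ∈ {x | u x ≤ ENNReal.ofReal 1} ∪ ⋃ j, D j := by
    filter_upwards [hufin] with x hx
    rcases le_or_gt (u x) (ENNReal.ofReal 1) with h | h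
    · exact Or.inl h
    · refine Or.inr (Set.mem_iUnion.2 ?_)
      have h1 : ∃ n : ℕ, u x ≤ ENNReal.ofReal (2 ^ n) := by
        obtain ⟨n, hn⟩ := pow_unbounded_of_one_lt (u x).toReal (one_lt_two : (1 : ℝ) < 2)
        exact ⟨n, (ENNReal.le_ofReal_iff_toReal_le hx.ne (by positivity)).2 hn.le⟩
      -- The least `n` with `u x ≤ 2^n` is positive because `u x > 1`; its predecessor is the index
      -- of the dyadic band.
      classical
      obtain ⟨m, hm⟩ : ∃ m, Nat.find h1 = m + 1 := by
        refine Nat.exists_eq_succ_of_ne_zero fun h0 => ?_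
        have := Nat.find_spec h1
        rw [h0, pow_zero] at this
        exact absurd h (not_lt.2 this)
      refine ⟨m, not_le.1 (Nat.find_min h1 (by omega)), ?_⟩
      have := Nat.find_spec h1
      rwa [hm] at this
  rw [← Measure.restrict_eq_self_of_ae_mem hcover]
  refine (lintegral_union_le _ _ _).trans_lt (ENNReal.add_lt_top.2 ⟨?_, ?_⟩)
  · refine (lintegral_rpow_sub_one_le hp hv.enorm.restrict).trans_lt (ENNReal.mul_lt_top ?_ ?_)
    · exact ENNReal.rpow_lt_top_of_nonneg (by positivity)
        (lintegral_energy_lt_top hp hu (hT 1 one_pos)).ne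
    · exact ENNReal.rpow_lt_top_of_nonneg (by positivity) (measure_ne_top _ _)
  · refine (lintegral_iUnion_le _ _).trans_lt ((ENNReal.tsum_le_tsum hD).trans_lt ?_)
    rw [ENNReal.tsum_mul_left, ENNReal.tsum_geometric]
    refine ENNReal.mul_lt_top hAtop.lt_top (ENNReal.inv_lt_top.2 (tsub_pos_of_lt ?_))
    rw [ENNReal.ofReal_lt_one]
    exact Real.rpow_lt_one_of_one_lt_of_neg one_lt_two (by linarith)

end GradientIntegrability

/-! ### Cutoff functions and their derivatives. -/

section Cutoff

/-- The cutoff function which is `1` on `[-t,t]`, `0` outside of `[-2t,2t]` and affine in between. -/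
noncomputable def cutoff (t s : ℝ) : ℝ := max 0 (min 1 (2 - |s| / t))

theorem cutoff_nonneg (t s : ℝ) : 0 ≤ cutoff t s := le_max_left _ _

theorem cutoff_le_one (t s : ℝ) : cutoff t s ≤ 1 := max_le zero_le_one (min_le_left _ _)

theorem cutoff_eq_one {t s : ℝ} (ht : 0 < t) (hs : |s| ≤ t) : cutoff t s = 1 := by
  have h : |s| / t ≤ 1 := (div_le_one ht).2 hs
  rw [cutoff, min_eq_left (by linarith), max_eq_right zero_le_one]

theorem cutoff_eq_zero {t s : ℝ} (ht : 0 < t) (hs : 2 * t ≤ |s|) : cutoff t s = 0 := by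
  have h : 2 ≤ |s| / t := (le_div_iff₀ ht).2 hs
  exact max_eq_left ((min_le_right _ _).trans (by linarith))

theorem lipschitzWith_cutoff (t : ℝ) : ∃ K, LipschitzWith K (cutoff t) := by
  have h : LipschitzWith (Real.nnabs t⁻¹) fun s : ℝ => 2 - |s| / t := by
    refine LipschitzWith.of_dist_le_mul fun x y => ?_
    rw [Real.dist_eq, Real.dist_eq, Real.coe_nnabs]
    have e : 2 - |x| / t - (2 - |y| / t) = -(t⁻¹ * (|x| - |y|)) := by ring
    rw [e, abs_neg, abs_mul]
    exact mul_le_mul_of_nonneg_left (abs_abs_sub_abs_le_abs_sub x y) (abs_nonneg _)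
  exact ⟨_, (h.const_min 1).const_max 0⟩

theorem hasCompactSupport_cutoff {t : ℝ} (ht : 0 < t) : HasCompactSupport (cutoff t) := by
  refine HasCompactSupport.intro (isCompact_Icc (a := -(2 * t)) (b := 2 * t)) fun s hs => ?_
  refine cutoff_eq_zero ht ?_
  by_contra h
  exact hs (abs_le.1 (not_le.1 h).le)

/-- Either `f` is differentiable at `s`, and its derivative is the one-sided one, or `deriv` takes
its default value `0`. -/
theorem deriv_eq_zero_of_eventuallyEq_within {f : ℝ → ℝ} {c s : ℝ} {D : Set ℝ}
    (hD : UniqueDiffWithinAt ℝ D s) (hs : s ∈ D) (h : f =ᶠ[𝓝[D] s] fun _ => c) :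
    deriv f s = 0 := by
  by_cases hf : DifferentiableAt ℝ f s
  · exact hD.eq_deriv _ hf.hasDerivAt.hasDerivWithinAt
      ((hasDerivWithinAt_const s D c).congr_of_eventuallyEq h (h.self_of_nhdsWithin hs))
  · exact deriv_zero_of_not_differentiableAt hf

/-- Valid also at the corners `t` and `2t`, where `deriv` is `0` by default. The open interval thus
matches the band `{t < u < 2t}` of the flux condition exactly, with no argument about level sets of
`u`. -/
theorem deriv_cutoff {t s : ℝ} (ht : 0 < t) (hs : 0 < s) :
    deriv (cutoff t) s = if t < s ∧ s < 2 * t then -(1 / t) else 0 := by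
  split_ifs with h
  · have h1 : cutoff t =ᶠ[𝓝 s] fun r => 2 - r / t := by
      filter_upwards [Ioo_mem_nhds h.1 h.2] with r hr
      have h2 : 1 ≤ r / t := (one_le_div ht).2 hr.1.le
      have h3 : r / t ≤ 2 := (div_le_iff₀ ht).2 hr.2.le
      rw [cutoff, abs_of_pos (ht.trans hr.1), min_eq_right (by linarith),
        max_eq_right (by linarith)]
    rw [h1.deriv_eq, deriv_const_sub]
    simp
  · rcases le_or_gt s t with h1 | h1
    · refine deriv_eq_zero_of_eventuallyEq_within (c := 1) (uniqueDiffWithinAt_Iic s)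
        Set.self_mem_Iic ?_
      filter_upwards [self_mem_nhdsWithin, mem_nhdsWithin_of_mem_nhds (Ioi_mem_nhds hs)]
        with r hr hr'
      exact cutoff_eq_one ht (by rw [abs_of_pos hr']; exact le_trans hr h1)
    · have h2 : 2 * t ≤ s := not_lt.1 fun h3 => h ⟨h1, h3⟩
      refine deriv_eq_zero_of_eventuallyEq_within (c := 0) (uniqueDiffWithinAt_Ici s)
        Set.self_mem_Ici ?_
      filter_upwards [self_mem_nhdsWithin] with r hr
      exact cutoff_eq_zero ht (h2.trans (le_trans hr (le_abs_self r)))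

theorem evalCompact_of_ne_top {S : ℝ → ℝ} {s : ℝ≥0∞} (hs : s ≠ ∞) :
    evalCompact S s = S s.toReal := if_neg hs

theorem evalCompact_cutoff_nonneg (t : ℝ) (s : ℝ≥0∞) : 0 ≤ evalCompact (cutoff t) s := by
  rw [evalCompact]
  split_ifs
  exacts [le_rfl, cutoff_nonneg _ _]

theorem evalCompact_cutoff_le_one (t : ℝ) (s : ℝ≥0∞) : evalCompact (cutoff t) s ≤ 1 := by
  rw [evalCompact]
  split_ifs
  exacts [zero_le_one, cutoff_le_one _ _]

theorem eventually_evalCompact_cutoff_eq_one {s : ℝ≥0∞} (hs : s ≠ ∞) :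
    ∀ᶠ t : ℝ in atTop, evalCompact (cutoff t) s = 1 := by
  filter_upwards [eventually_ge_atTop s.toReal, eventually_gt_atTop 0] with t ht ht0
  rw [evalCompact_of_ne_top hs]
  exact cutoff_eq_one ht0 (by rwa [abs_of_nonneg ENNReal.toReal_nonneg])

theorem evalCompact_deriv_cutoff {t : ℝ} (ht : 0 < t) {s : ℝ≥0∞} (hs : 0 < s) (hs' : s < ∞) :
    evalCompact (deriv (cutoff t)) s =
      if ENNReal.ofReal t < s ∧ s < ENNReal.ofReal (2 * t) then -(1 / t) else 0 := by
  rw [evalCompact_of_ne_top hs'.ne, deriv_cutoff ht (ENNReal.toReal_pos hs.ne' hs'.ne)]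
  simp only [ENNReal.ofReal_lt_iff_lt_toReal ht.le hs'.ne,
    ENNReal.lt_ofReal_iff_toReal_lt hs'.ne]

end Cutoff

/-! ### The terms of the renormalized equation that contain the flux. -/

section Limit

variable {N : ℕ} {Ω : Set (RN N)} {p : ℝ} {u : RN N → ℝ≥0∞} {v : RN N → RN N}

theorem measurable_evalCompact_cutoff (t : ℝ) : Measurable (evalCompact (cutoff t)) := by
  refine Measurable.ite (measurableSet_singleton _) measurable_const ?_
  obtain ⟨K, hK⟩ := lipschitzWith_cutoff t
  exact hK.continuous.measurable.comp ENNReal.measurable_toReal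

theorem integral_flux_deriv_cutoff (hu : AEMeasurable u (volume.restrict Ω))
    (hupos : ∀ᵐ x ∂(volume.restrict Ω), 0 < u x ∧ u x < ∞) {t : ℝ} (ht : 0 < t)
    (F φ : RN N → ℝ) :
    ∫ x in Ω, F x * evalCompact (deriv (cutoff t)) (u x) * φ x =
      -((1 / t) * ∫ x in {x | x ∈ Ω ∧ ENNReal.ofReal t < u x ∧ u x < ENNReal.ofReal (2 * t)},
        F x * φ x) := by
  rw [restrict_band_eq hu, ← integral_indicator₀ (nullMeasurableSet_band hu t), ← neg_mul,
    ← integral_const_mul]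
  refine integral_congr_ae ?_
  filter_upwards [hupos] with x hx
  rw [evalCompact_deriv_cutoff ht hx.1 hx.2, Set.indicator_apply]
  simp only [Set.mem_ofPred_eq]
  split_ifs
  · ring
  · simp

/-- Dominated convergence with majorant `β M |∇u|^{p-1}`; since `u` is finite a.e., the cutoffs at
`u` are eventually equal to `1`. -/
theorem tendsto_integral_flux_cutoff {a : RN N → RN N → RN N} (ha : IsLerayLions Ω p a)
    (hu : AEMeasurable u (volume.restrict Ω))
    (hupos : ∀ᵐ x ∂(volume.restrict Ω), 0 < u x ∧ u x < ∞)
    (hv : AEStronglyMeasurable v (volume.restrict Ω))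
    (hint : IntegrableOn (fun x => ‖v x‖ ^ (p - 1)) Ω volume) {G : RN N → RN N}
    (hG : Continuous G) {M : ℝ} (hM : ∀ x, ‖G x‖ ≤ M) :
    Tendsto (fun n : ℕ => ∫ x in Ω, inner ℝ (a x (v x)) (G x) *
      evalCompact (cutoff ((n : ℝ) + 1)) (u x)) atTop (𝓝 (∫ x in Ω, inner ℝ (a x (v x)) (G x))) := by
  obtain ⟨β, hβ, hgr⟩ := ha.growth
  have hm : AEStronglyMeasurable (fun x => (inner ℝ (a x (v x)) (G x) : ℝ))
      (volume.restrict Ω) := (ha.aestronglyMeasurable_comp hv).inner hG.aestronglyMeasurable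
  have htop : Tendsto (fun n : ℕ => (n : ℝ) + 1) atTop atTop :=
    tendsto_atTop_add_const_right _ _ tendsto_natCast_atTop_atTop
  refine tendsto_integral_of_dominated_convergence (fun x => β * ‖v x‖ ^ (p - 1) * M)
    (fun n => hm.mul ((measurable_evalCompact_cutoff _).comp_aemeasurable hu).aestronglyMeasurable)
    ((hint.const_mul β).mul_const M) (fun n => ?_) ?_
  · filter_upwards [hgr] with x hx
    have hM0 : 0 ≤ M := (norm_nonneg _).trans (hM x)
    rw [norm_mul, Real.norm_of_nonneg (evalCompact_cutoff_nonneg _ _)]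
    calc _ ≤ ‖(inner ℝ (a x (v x)) (G x) : ℝ)‖ * 1 :=
          mul_le_mul_of_nonneg_left (evalCompact_cutoff_le_one _ _) (norm_nonneg _)
      _ ≤ ‖a x (v x)‖ * ‖G x‖ := by rw [mul_one]; exact norm_inner_le_norm _ _
      _ ≤ _ := by gcongr; exacts [hx _, hM _]
  · filter_upwards [hupos] with x hx
    refine tendsto_const_nhds.congr' ?_
    filter_upwards [htop.eventually (eventually_evalCompact_cutoff_eq_one hx.2.ne)] with n hn
    rw [hn, mul_one]

end Limit

/-! ### The term with the diffuse measure. -/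

section DiffuseTerm

variable {N : ℕ} {Ω : Set (RN N)} {μd : Measure (RN N)} {H : ℝ → ℝ} {w : RN N → ℝ≥0∞}

/-- Finiteness of `w` is essential: `evalCompact` is `0` at `∞` for every cutoff. -/
theorem ae_tendsto_diffuse_cutoff (hw : ∀ᵐ x ∂(μd.restrict Ω), 0 < w x ∧ w x < ∞)
    (φ : RN N → ℝ) :
    ∀ᵐ x ∂(μd.restrict Ω), Tendsto (fun n : ℕ => H (w x).toReal *
      evalCompact (cutoff ((n : ℝ) + 1)) (w x) * φ x) atTop (𝓝 (H (w x).toReal * φ x)) := by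
  have htop : Tendsto (fun n : ℕ => (n : ℝ) + 1) atTop atTop :=
    tendsto_atTop_add_const_right _ _ tendsto_natCast_atTop_atTop
  filter_upwards [hw] with x hx
  refine tendsto_const_nhds.congr' ?_
  filter_upwards [htop.eventually (eventually_evalCompact_cutoff_eq_one hx.2.ne)] with n hn
  rw [hn, mul_one]

/-- If the integrals of `H(u) S_n(u) φ` converge, where `S_n` are cutoff functions and `φ ≥ 0`,
then `H(u) φ` is integrable. -/
theorem integrableOn_diffuse_of_tendsto (hH : ∀ s, 0 < s → 0 < H s)
    (hw : ∀ᵐ x ∂(μd.restrict Ω), 0 < w x ∧ w x < ∞) {φ : RN N → ℝ} (hφ : ∀ x, 0 ≤ φ x)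
    (hint : ∀ n : ℕ, IntegrableOn (fun x => H (w x).toReal *
      evalCompact (cutoff ((n : ℝ) + 1)) (w x) * φ x) Ω μd)
    {R : ℝ} (hR : Tendsto (fun n : ℕ => ∫ x in Ω, H (w x).toReal *
      evalCompact (cutoff ((n : ℝ) + 1)) (w x) * φ x ∂μd) atTop (𝓝 R)) :
    IntegrableOn (fun x => H (w x).toReal * φ x) Ω μd := by
  have hlim := ae_tendsto_diffuse_cutoff (H := H) hw φ
  refine ⟨aestronglyMeasurable_of_tendsto_ae atTop (fun n => (hint n).1) hlim, ?_⟩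
  have hpos : ∀ n : ℕ, 0 ≤ᵐ[μd.restrict Ω] fun x => H (w x).toReal *
      evalCompact (cutoff ((n : ℝ) + 1)) (w x) * φ x := fun n => by
    filter_upwards [hw] with x hx
    exact mul_nonneg (mul_nonneg (hH _ (ENNReal.toReal_pos hx.1.ne' hx.2.ne)).le
      (evalCompact_cutoff_nonneg _ _)) (hφ x)
  -- Fatou's lemma; nonnegativity turns the lower integrals into the integrals whose limit is `R`.
  calc ∫⁻ x in Ω, ‖H (w x).toReal * φ x‖ₑ ∂μd
      = ∫⁻ x in Ω, liminf (fun n : ℕ => ‖H (w x).toReal *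
          evalCompact (cutoff ((n : ℝ) + 1)) (w x) * φ x‖ₑ) atTop ∂μd := by
        refine lintegral_congr_ae ?_
        filter_upwards [hlim] with x hx
        exact hx.enorm.liminf_eq.symm
    _ ≤ liminf (fun n : ℕ => ∫⁻ x in Ω, ‖H (w x).toReal *
          evalCompact (cutoff ((n : ℝ) + 1)) (w x) * φ x‖ₑ ∂μd) atTop :=
        lintegral_liminf_le' fun n => (hint n).1.enorm
    _ = liminf (fun n : ℕ => ENNReal.ofReal (∫ x in Ω, H (w x).toReal *
          evalCompact (cutoff ((n : ℝ) + 1)) (w x) * φ x ∂μd)) atTop := by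
        congr 1
        ext1 n
        rw [ofReal_integral_eq_lintegral_ofReal (hint n) (hpos n)]
        refine lintegral_congr_ae ?_
        filter_upwards [hpos n] with x hx
        exact Real.enorm_eq_ofReal hx
    _ = ENNReal.ofReal R := (ENNReal.tendsto_ofReal hR).liminf_eq
    _ < ⊤ := ENNReal.ofReal_lt_top

/-- Once `H(u) φ` is known to be integrable it dominates the sequence, so `φ` may change sign here.
-/
theorem tendsto_integral_diffuse_cutoff
    (hw : ∀ᵐ x ∂(μd.restrict Ω), 0 < w x ∧ w x < ∞) {φ : RN N → ℝ}
    (hint : ∀ n : ℕ, IntegrableOn (fun x => H (w x).toReal *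
      evalCompact (cutoff ((n : ℝ) + 1)) (w x) * φ x) Ω μd)
    (hφ : IntegrableOn (fun x => H (w x).toReal * φ x) Ω μd) :
    Tendsto (fun n : ℕ => ∫ x in Ω, H (w x).toReal *
      evalCompact (cutoff ((n : ℝ) + 1)) (w x) * φ x ∂μd) atTop
      (𝓝 (∫ x in Ω, H (w x).toReal * φ x ∂μd)) := by
  refine tendsto_integral_of_dominated_convergence (fun x => ‖H (w x).toReal * φ x‖)
    (fun n => (hint n).1) hφ.norm (fun n => .of_forall fun x => ?_)
    (ae_tendsto_diffuse_cutoff hw φ)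
  rw [mul_right_comm, norm_mul, Real.norm_of_nonneg (evalCompact_cutoff_nonneg _ _)]
  exact mul_le_of_le_one_right (norm_nonneg _) (evalCompact_cutoff_le_one _ _)

/-- Local integrability of `f` follows from the integrability of `f φ` for test functions `φ ≥ 0`. -/
theorem locallyIntegrableOn_of_isTestFunction (hΩ : IsOpen Ω) {f : RN N → ℝ}
    (h : ∀ φ : RN N → ℝ, IsTestFunction Ω φ → (∀ x, 0 ≤ φ x) →
      IntegrableOn (fun x => f x * φ x) Ω μd) : LocallyIntegrableOn f Ω μd := by
  intro x hx
  obtain ⟨r, hr, hball⟩ := Metric.isOpen_iff.1 hΩ x hx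
  let b : ContDiffBump x := ⟨r / 4, r / 2, by positivity, by linarith⟩
  have hb : IsTestFunction Ω b := by
    refine ⟨b.contDiff, b.hasCompactSupport, ?_⟩
    rw [b.tsupport_eq]
    exact (Metric.closedBall_subset_ball (by change r / 2 < r; linarith)).trans hball
  refine ⟨Metric.ball x (r / 4), mem_nhdsWithin_of_mem_nhds (Metric.ball_mem_nhds x (by positivity)),
    ?_⟩
  have h1 : IntegrableOn (fun y => f y * b y) (Metric.ball x (r / 4)) μd :=
    (h b hb fun y => b.nonneg).mono_set
      ((Metric.ball_subset_ball (by linarith)).trans hball)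
  refine h1.congr_fun (fun y hy => ?_) Metric.isOpen_ball.measurableSet
  simp only
  rw [b.one_of_mem_closedBall (Metric.ball_subset_closedBall hy), mul_one]

theorem integrableOn_mul_of_hasCompactSupport {f φ : RN N → ℝ} (hf : LocallyIntegrableOn f Ω μd)
    (hφ : Continuous φ) (hφc : HasCompactSupport φ) (hφΩ : tsupport φ ⊆ Ω) :
    IntegrableOn (fun x => f x * φ x) Ω μd := by
  have h : IntegrableOn (fun x => f x * φ x) (tsupport φ) μd :=
    (hf.integrableOn_compact_subset hφΩ hφc.isCompact).mul_continuousOn hφ.continuousOn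
      hφc.isCompact
  rw [integrableOn_iff_integrable_of_support_subset] at h
  · exact h.integrableOn
  · intro x hx
    refine subset_tsupport _ fun h4 => hx ?_
    simp [h4]

end DiffuseTerm

/-! ### Passage to the limit in the renormalized equation. -/

theorem lemma3p3 {N : ℕ} {p γ : ℝ} (hp : 1 < p) (hpN : p < N)
    {Ω : Set (RN N)} (hΩ : IsOpen Ω) (hΩb : Bornology.IsBounded Ω)
    (a : RN N → RN N → RN N) (ha : IsLerayLions Ω p a)
    (μ μd μc : Measure (RN N)) [IsFiniteMeasure μ] (hμ : μ Ωᶜ = 0)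
    (hdec : IsCapacityDecomposition Ω p μ μd μc)
    (H : ℝ → ℝ) (Hinf : ℝ) (hH : IsSingularNonlinearity H Hinf γ) (hγ : γ ≤ 1)
    (u : RN N → ℝ≥0∞) (hu : IsRenormalizedSolution Ω p a μd μc H Hinf u) :
    IsDistributionalSolution Ω p a μd μc H Hinf γ u := by
  obtain ⟨hum, hupos, hW, v, w, hgrad, hrep, hwpos, heq, hlim⟩ := hu
  have hp0 : 0 < p := by linarith
  have hvm := hgrad.aestronglyMeasurable
  have hT : ∀ k : ℝ, 0 < k → HasW0Gradient Ω p (fun x => trunc k (u x))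
      ({x | u x ≤ ENNReal.ofReal k}.indicator v) := fun k hk => by
    obtain ⟨g, hg⟩ := hW k hk
    exact hg.congr_grad hΩ (hgrad.hasWeakGradient k hk)
  obtain ⟨C, hC, hE⟩ : ∃ C : ℝ≥0∞, C ≠ ⊤ ∧ ∀ k : ℝ, 1 ≤ k →
      ∫⁻ x in {x | u x ≤ ENNReal.ofReal k}, ‖v x‖ₑ ^ p ∂(volume.restrict Ω) ≤
        C * ENNReal.ofReal k := by
    -- The flux condition admits all bounded continuous functions, not only compactly supported
    -- ones; it is applied to the constant `1`.
    refine exists_energy_bound ha hp hum hvm hT (ℓ := Hinf * ∫ x in Ω, (1 : ℝ) ∂μc) ?_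
    simpa only [mul_one] using hlim (fun _ => 1) continuousOn_const ⟨1, fun x _ => by simp⟩
  have hvint : IntegrableOn (fun x => ‖v x‖ ^ (p - 1)) Ω volume := by
    refine ⟨(hvm.norm.aemeasurable.pow_const _).aestronglyMeasurable, ?_⟩
    refine lt_of_eq_of_lt (lintegral_congr fun x => ?_)
      (lintegral_grad_rpow_lt_top hΩb hp hpN hum (hupos.mono fun x hx => hx.2) hvm hT hC hE)
    rw [Real.enorm_eq_ofReal (by positivity), ofReal_norm_rpow (by linarith)]
  have hw : ∀ᵐ x ∂(μd.restrict Ω), 0 < w x ∧ w x < ∞ := by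
    obtain ⟨B, hB, hBΩ, hBcap, hwB⟩ := exists_measurableSet_pCapacity_eq_zero hΩ hΩb hp hrep hT hC
      fun k hk => (lintegral_indicator_rpow hp0 hum k).trans_le (hE k hk)
    have h1 : ∀ᵐ x ∂μd, x ∉ B := measure_eq_zero_iff_ae_notMem.1 (hdec.diffuse B hB hBΩ hBcap)
    filter_upwards [hwpos, ae_restrict_of_ae h1, ae_restrict_mem hΩ.measurableSet] with x h2 h3 h4
    exact ⟨h2, lt_top_iff_ne_top.2 fun h5 => h3 (hwB x h4 h5)⟩
  have htop : Tendsto (fun n : ℕ => (n : ℝ) + 1) atTop atTop :=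
    tendsto_atTop_add_const_right _ _ tendsto_natCast_atTop_atTop
  -- the renormalized equation for cutoff functions, and its limit
  have hcut : ∀ φ : RN N → ℝ, ContDiff ℝ 1 φ → HasCompactSupport φ → tsupport φ ⊆ Ω →
      (∀ n : ℕ, IntegrableOn (fun x => H (w x).toReal *
        evalCompact (cutoff ((n : ℝ) + 1)) (w x) * φ x) Ω μd) ∧
      Tendsto (fun n : ℕ => ∫ x in Ω, H (w x).toReal *
        evalCompact (cutoff ((n : ℝ) + 1)) (w x) * φ x ∂μd) atTop
        (𝓝 ((∫ x in Ω, inner ℝ (a x (v x)) (gradient φ x)) - Hinf * ∫ x in Ω, φ x ∂μc)) := by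
    intro φ hφ hφc hφΩ
    have h := fun n : ℕ => heq (cutoff ((n : ℝ) + 1)) (lipschitzWith_cutoff _)
      (hasCompactSupport_cutoff (by positivity)) φ (gradient φ)
      (hasW0Gradient_of_contDiff hΩ hΩb hφ hφc hφΩ)
      ((hφ.continuous.memLp_of_hasCompactSupport hφc).restrict _)
      (hφ.continuous.continuousOn.isQuasiContinuous hΩ hΩb hp)
    refine ⟨fun n => (h n).1, ?_⟩
    obtain ⟨M, hM⟩ := (continuous_gradient_of_contDiff hφ).bounded_above_of_compact_support
      (hasCompactSupport_gradient hφc)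
    obtain ⟨M', hM'⟩ := hφ.continuous.bounded_above_of_compact_support hφc
    have h1 := tendsto_integral_flux_cutoff ha hum hupos hvm hvint
      (continuous_gradient_of_contDiff hφ) hM
    have h2 := (hlim φ hφ.continuous.continuousOn ⟨M', fun x _ => hM' x⟩).comp htop
    refine (h1.sub h2).congr fun n => ?_
    rw [← (h n).2, integral_flux_deriv_cutoff hum hupos (by positivity), sub_eq_add_neg]
    rfl
  -- Nonnegative test functions come before general ones: Fatou's lemma gives integrability, which
  -- then permits dominated convergence for `φ` of either sign.
  have hloc : LocallyIntegrableOn (fun x => H (w x).toReal) Ω μd := by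
    refine locallyIntegrableOn_of_isTestFunction hΩ fun φ hφ hφ0 => ?_
    obtain ⟨h1, h2⟩ := hcut φ hφ.contDiff_one hφ.hasCompactSupport hφ.tsupport_subset
    exact integrableOn_diffuse_of_tendsto hH.pos hw hφ0 h1 h2
  refine ⟨hum, hupos, fun k hk => ?_, v, w, hgrad, hvint.locallyIntegrableOn, hrep, hw, hloc,
    fun φ hφ hφc hφΩ => ?_⟩
  -- Here `max 1 γ = 1`, so the exponent is `p/p = 1`.
  · simpa [max_eq_left hγ, hp0.ne'] using hW k hk
  · obtain ⟨h1, h2⟩ := hcut φ hφ hφc hφΩ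
    have h3 := tendsto_nhds_unique h2 (tendsto_integral_diffuse_cutoff hw h1
      (integrableOn_mul_of_hasCompactSupport hloc hφ.continuous hφc hφΩ))
    linarith
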